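/- Let $d\ge 2$, let $T$ be a $(d+1)$-regular tree and let $\xi$ be an end of $T$ (an equivalence class of rays, i.e. half-infinite simple paths, where two rays are equivalent if they differ in only finitely many edges). Let $L$ be a subgroup of the group of those automorphisms of $T$ that fix $\xi$, and suppose that $L$ acts transitively on $V(T)$. Let $E'$ be a set of unordered pairs of distinct vertices of $T$ with $L\cdot E'=E'$ such that the graph $G=(V(T),E(T)\cup E')$ is locally finite; such a graph $G$ is called a decorated tree. For $p\in[0,1]$ let $\mathbb P_p$ denote Bernoulli bond percolation on $G$, in which each edge of $G$ is open independently with probability $p$; the clusters are the connected components of the subgraph formed by the open edges, and $p_c=\inf\{p\in[0,1]:\mathbb P_p(\text{there is an infinite cluster})=1\}$. Then: 1. $\mathbb P_{p_c}$-almost surely there is no infinite cluster. 2. For every $p\in[0,1)$ there is a constant $c=c_p>0$ (depending only on $G$ and $p$) such that for all vertices $x,y$ of $G$, $$\mathbb P_p(x\longleftrightarrow y)\le e^{-c\,\operatorname{dist}(x,y)},$$ where $x\longleftrightarrow y$ means that $x$ and $y$ are in the same cluster and $\operatorname{dist}$ is the graph distance in $G$. -/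

import Mathlib

open MeasureTheory ProbabilityTheory

namespace SimpleGraph

/-- A ray of `T`: a half-infinite simple path. -/
structure Ray {V : Type*} (T : SimpleGraph V) where
  /-- the successive vertices of the ray -/
  vertex : ℕ → V
  adj : ∀ n, T.Adj (vertex n) (vertex (n + 1))
  injective : Function.Injective vertex

/-- The set of edges traversed by a ray. -/
def Ray.edges {V : Type*} {T : SimpleGraph V} (r : T.Ray) : Set (Sym2 V) :=
  Set.range fun n => s(r.vertex n, r.vertex (n + 1))

/-- The image of a ray under an automorphism. -/
def Ray.map {V : Type*} {T : SimpleGraph V} (g : T ≃g T) (r : T.Ray) : T.Ray where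
  vertex n := g (r.vertex n)
  adj n := g.map_adj_iff.2 (r.adj n)
  injective := g.injective.comp r.injective

theorem Ray.edges_map {V : Type*} {T : SimpleGraph V} (g : T ≃g T) (r : T.Ray) :
    (r.map g).edges = Sym2.map g '' r.edges := by
  ext e
  simp [Ray.edges, Ray.map]

/-- Two rays of a tree are equivalent if they differ only in finitely many edges. -/
def raySetoid {V : Type*} (T : SimpleGraph V) : Setoid T.Ray where
  r a b := (symmDiff a.edges b.edges).Finite
  iseqv :=
    { refl := fun a => by simp
      symm := fun {a b} h => by rwa [symmDiff_comm]
      trans := fun {a b c} h₁ h₂ => (h₁.union h₂).subset (symmDiff_triangle _ _ _) }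

/-- An end of the tree `T`: an equivalence class of rays. -/
def TreeEnd {V : Type*} (T : SimpleGraph V) : Type _ := Quotient T.raySetoid

/-- The action of an automorphism of `T` on the ends of `T`. -/
def TreeEnd.map {V : Type*} {T : SimpleGraph V} (g : T ≃g T) : T.TreeEnd → T.TreeEnd :=
  Quotient.map (Ray.map g) fun a b h => by
    change (symmDiff (a.map g).edges (b.map g).edges).Finite
    rw [Ray.edges_map, Ray.edges_map, ← Set.image_symmDiff (Sym2.map.injective g.injective)]
    exact Set.Finite.image _ h

/-- `G` is a decorated tree: there are a `(d + 1)`-regular tree `T` with `d ≥ 2` on the vertex set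
of `G`, an end `ξ` of `T`, a group `L` of automorphisms of `T` that fix `ξ`, acting transitively on
the vertices, and an `L`-invariant set `E'` of extra edges, such that `G` is locally finite and
has edge set `E(T) ∪ E'`. -/
def IsDecoratedTree {V : Type*} (G : SimpleGraph V) : Prop :=
  ∃ (d : ℕ) (T : SimpleGraph V) (ξ : T.TreeEnd) (L : Subgroup (T ≃g T)) (E' : Set (Sym2 V)),
    2 ≤ d ∧
    T.IsTree ∧
    (∃ _ : T.LocallyFinite, T.IsRegularOfDegree (d + 1)) ∧
    (∀ g ∈ L, TreeEnd.map g ξ = ξ) ∧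
    (∀ u v : V, ∃ g ∈ L, g u = v) ∧
    (∀ g ∈ L, Sym2.map g '' E' = E') ∧
    G = T ⊔ fromEdgeSet E' ∧
    Nonempty G.LocallyFinite

/-- Bernoulli bond percolation on `G`: the law of a random set of (open) edges that contains each
edge of `G` independently with probability `p`. -/
noncomputable def percolation {V : Type*} (G : SimpleGraph V) (p : unitInterval) :
    Measure (Set (Sym2 V)) :=
  setBernoulli G.edgeSet p

/-- The subgraph of `G` formed by the open edges of the configuration `ω`. -/
def openSubgraph {V : Type*} (G : SimpleGraph V) (ω : Set (Sym2 V)) : SimpleGraph V :=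
  fromEdgeSet (ω ∩ G.edgeSet)

/-- The cluster of `o`: the vertices connected to `o` by an open path. -/
def cluster {V : Type*} (G : SimpleGraph V) (ω : Set (Sym2 V)) (o : V) : Set V :=
  {v | (G.openSubgraph ω).Reachable o v}

/-- The critical probability: the infimum, in `[0, 1]`, of those `p` for which an infinite cluster
exists with probability `1`. -/
noncomputable def criticalProb {V : Type*} (G : SimpleGraph V) : unitInterval :=
  sInf {p | G.percolation p {ω | ∃ o, (G.cluster ω o).Infinite} = 1}

end SimpleGraph

/-!
Fix the end of the tree and call the next vertex towards it the *parent* of a vertex. Every vertex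
then has a set of descendants, and since the automorphisms fixing the end are transitive and the
graph is locally finite, each edge of the decorated tree joins vertices with a common ancestor at
bounded distance (`Genealogy.exists_range`). This structure, `SimpleGraph.Genealogy`, is extracted
from the tree and the end in `IsDecoratedTree.nonempty_genealogy`, and is all that is used about
the graph.

*Exponential decay.* The edges between the descendants of a vertex and the rest of the graph form a
finite cut of bounded size, and the cuts of ancestors that are far apart are disjoint. If `x` and
`y` are at distance `n`, then one of them is separated from the other by a number of disjoint cuts
that is linear in `n`. These contain an open edge independently, and each one with probability
bounded away from one (`Genealogy.exists_real_connEvent_le_exp`).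

*No percolation at the critical point.* Let `meanOffspring n x p` be the expected number of
descendants of `x` in generation `n` that are joined to `x` by open edges that touch the generations
before `n`. Restarting from these vertices, whose descendants span disjoint sets of unexplored
edges, embeds a branching process in the cluster of `x`; if `meanOffspring n x p > 1` for some `n`,
it survives with positive probability, and there is almost surely an infinite cluster
(`Genealogy.measure_exists_infinite_eq_one`). Conversely, if infinite clusters have positive
probability for some `p < 1`, then the cuts confine each cluster to the descendants of one vertex,
so that some vertex has an infinite cluster among its descendants with positive probability
(`Genealogy.exists_infiniteBelow_pos`). On that event the number of vertices reached in late
generations is unlikely to stay bounded, as a bounded front dies out with probability bounded below;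
hence its expectation is unbounded and `meanOffspring n x p > 1` for some `n`
(`Genealogy.exists_one_lt_meanOffspring`). As `meanOffspring n x p` depends on finitely many edges,
it is continuous in `p`. So if there were an infinite cluster at the critical value, there would
also be one for some smaller `p`, a contradiction.
-/

/-! ### Random sets with independent elements -/

namespace ProbabilityTheory

variable {ι : Type*} {u : Set ι} {p : unitInterval}

/-- The event `A` only depends on which elements of `F` belong to the random set. -/
def DeterminedBy (A : Set (Set ι)) (F : Set ι) : Prop :=
  ∀ ω ω' : Set ι, ω ∩ F = ω' ∩ F → (ω ∈ A ↔ ω' ∈ A)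

namespace DeterminedBy

variable {A B : Set (Set ι)} {F F' : Set ι}

theorem mono (h : DeterminedBy A F) (hF : F ⊆ F') : DeterminedBy A F' := fun ω ω' hω =>
  h ω ω' (by
    rw [← Set.inter_eq_right.2 hF, ← Set.inter_assoc, ← Set.inter_assoc, hω])

theorem inter (hA : DeterminedBy A F) (hB : DeterminedBy B F) : DeterminedBy (A ∩ B) F :=
  fun ω ω' hω => and_congr (hA ω ω' hω) (hB ω ω' hω)

theorem compl (hA : DeterminedBy A F) : DeterminedBy Aᶜ F :=
  fun ω ω' hω => not_congr (hA ω ω' hω)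

theorem iUnion {κ : Sort*} {A : κ → Set (Set ι)} (hA : ∀ k, DeterminedBy (A k) F) :
    DeterminedBy (⋃ k, A k) F := fun ω ω' hω => by
  simp only [Set.mem_iUnion]
  exact exists_congr fun k => hA k ω ω' hω

theorem iInter {κ : Sort*} {A : κ → Set (Set ι)} (hA : ∀ k, DeterminedBy (A k) F) :
    DeterminedBy (⋂ k, A k) F := fun ω ω' hω => by
  simp only [Set.mem_iInter]
  exact forall_congr' fun k => hA k ω ω' hω

theorem of_inter_iff (h : ∀ ω, ω ∈ A ↔ ω ∩ F ∈ A) : DeterminedBy A F := fun ω ω' hω => by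
  rw [h ω, h ω', hω]

theorem inter_mem_iff (h : DeterminedBy A F) (ω : Set ι) : ω ∩ F ∈ A ↔ ω ∈ A :=
  h _ _ (by rw [Set.inter_assoc, Set.inter_self])

end DeterminedBy

theorem determinedBy_subset {F : Set ι} : DeterminedBy {ω : Set ι | F ⊆ ω} F :=
  .of_inter_iff fun ω => by simp

theorem determinedBy_disjoint {F : Set ι} : DeterminedBy {ω : Set ι | Disjoint ω F} F :=
  .of_inter_iff fun ω => by
    simp only [Set.mem_ofPred_eq, Set.disjoint_iff_inter_eq_empty, Set.inter_assoc, Set.inter_self]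

theorem iIndep_coordinate :
    iIndep (fun i => MeasurableSpace.comap (fun ω : Set ι => i ∈ ω) ⊤) (setBernoulli u p) := by
  have h := iIndepFun_infinitePi (P := fun i : ι =>
    (unitInterval.toNNReal p • Measure.dirac (i ∈ u) +
      unitInterval.toNNReal (unitInterval.symm p) • Measure.dirac False : Measure Prop))
    (X := fun _ (a : Prop) => a) (fun i => measurable_id)
  have h2 : iIndepFun (fun i (ω : Set ι) => i ∈ ω) (setBernoulli u p) := by
    rw [setBernoulli_eq_map]
    refine iIndepFun_iff_measure_inter_preimage_eq_mul.2 fun S sets hs => ?_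
    have hm : Measurable (fun p : ι → Prop => {i | p i}) :=
      MeasurableEquiv.setOfPred.measurable
    have hmem (i : ι) : MeasurableSet ((fun ω : Set ι => i ∈ ω) ⁻¹' sets i) :=
      (by fun_prop : Measurable fun ω : Set ι => i ∈ ω) (MeasurableSpace.measurableSet_top)
    rw [Measure.map_apply hm (Finset.measurableSet_biInter _ fun i _ => hmem i)]
    have := iIndepFun_iff_measure_inter_preimage_eq_mul.1 h S (sets := sets) fun i _ =>
      MeasurableSpace.measurableSet_top
    rw [Finset.prod_congr rfl fun i _ => Measure.map_apply hm (hmem i)]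
    exact this
  exact h2

/-- Events determined by disjoint sets of elements are independent. -/
theorem real_inter_of_determinedBy {A B : Set (Set ι)} {F F' : Set ι} (hA : MeasurableSet A)
    (hB : MeasurableSet B) (hAF : DeterminedBy A F) (hBF : DeterminedBy B F')
    (hF : Disjoint F F') :
    (setBernoulli u p).real (A ∩ B) = (setBernoulli u p).real A * (setBernoulli u p).real B := by
  have key : ∀ {A : Set (Set ι)} {F : Set ι}, MeasurableSet A → DeterminedBy A F →
      MeasurableSet[⨆ i ∈ F, MeasurableSpace.comap (fun ω : Set ι => i ∈ ω) ⊤] A := by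
    intro A F hA hAF
    have hm : @Measurable _ _ (⨆ i ∈ F, MeasurableSpace.comap (fun ω : Set ι => i ∈ ω) ⊤) _
        (fun ω : Set ι => ω ∩ F) := by
      refine (@measurable_set_iff _ _ (⨆ i ∈ F, MeasurableSpace.comap
        (fun ω : Set ι => i ∈ ω) ⊤) _).2 fun i => ?_
      by_cases hi : i ∈ F
      · have : (fun ω : Set ι => i ∈ ω ∩ F) = fun ω => i ∈ ω := by
          ext; simp [hi]
        rw [this, measurable_iff_comap_le]
        exact le_iSup₂_of_le i hi le_rfl
      · have : (fun ω : Set ι => i ∈ ω ∩ F) = fun ω => False := by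
          ext; simp [hi]
        rw [this]
        exact measurable_const
    have := hm hA
    convert this using 1
    ext ω
    exact (hAF.inter_mem_iff ω).symm
  have hind := indep_iSup_of_disjoint (fun i => Measurable.comap_le (by fun_prop))
    (iIndep_coordinate (u := u) (p := p)) hF
  have := (Indep_iff _ _ _).1 hind A B (key hA hAF) (key hB hBF)
  simp [measureReal_def, this]

theorem measurableSet_cylinder_mem (F : Finset ι) (η : Set ι) :
    MeasurableSet {ω : Set ι | ∀ i ∈ F, (i ∈ ω ↔ i ∈ η)} := by
  have : {ω : Set ι | ∀ i ∈ F, (i ∈ ω ↔ i ∈ η)} =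
      ⋂ i ∈ F, (fun ω : Set ι => i ∈ ω) ⁻¹' {i ∈ η} := by
    ext; simp
  rw [this]
  exact Finset.measurableSet_biInter _ fun i _ =>
    (by fun_prop : Measurable fun ω : Set ι => i ∈ ω) (measurableSet_singleton _)

open Classical in
theorem real_cylinder (F : Finset ι) (η : Set ι) :
    (setBernoulli u p).real {ω : Set ι | ∀ i ∈ F, (i ∈ ω ↔ i ∈ η)} =
      ∏ i ∈ F, ((if i ∈ u ↔ i ∈ η then (p : ℝ) else 0) + if i ∈ η then 0 else (1 - p : ℝ)) := by
  have h1 : (fun p : ι → Prop => {i | p i}) ⁻¹' {ω : Set ι | ∀ i ∈ F, (i ∈ ω ↔ i ∈ η)} =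
      Set.pi F fun i => {i ∈ η} := by
    ext; simp [Set.pi]
  rw [measureReal_def, setBernoulli_apply', h1, Measure.infinitePi_pi]
  · rw [ENNReal.toReal_prod]
    refine Finset.prod_congr rfl fun i _ => ?_
    rw [Measure.add_apply, ENNReal.toReal_add (measure_ne_top _ _) (measure_ne_top _ _)]
    by_cases h : i ∈ u <;> by_cases h' : i ∈ η <;> simp [h, h', Set.indicator]
  · intro i _
    exact measurableSet_singleton _

theorem real_subset (F : Finset ι) (hF : (F : Set ι) ⊆ u) :
    (setBernoulli u p).real {ω : Set ι | (F : Set ι) ⊆ ω} = (p : ℝ) ^ F.card := by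
  classical
  have := real_cylinder (u := u) (p := p) F Set.univ
  simp only [Set.mem_univ, iff_true, if_true, add_zero] at this
  rw [Finset.prod_congr rfl fun i hi => if_pos (hF hi), Finset.prod_const] at this
  exact this

theorem pow_card_le_real_disjoint (F : Finset ι) :
    (1 - p : ℝ) ^ F.card ≤ (setBernoulli u p).real {ω : Set ι | Disjoint ω (F : Set ι)} := by
  classical
  have := real_cylinder (u := u) (p := p) F ∅
  have h2 : {ω : Set ι | Disjoint ω (F : Set ι)} =
      {ω : Set ι | ∀ i ∈ F, (i ∈ ω ↔ i ∈ (∅ : Set ι))} := by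
    ext ω
    simp [Set.disjoint_right]
  rw [h2, this, ← Finset.prod_const]
  refine Finset.prod_le_prod (fun i _ => by linarith [p.2.2]) fun i _ => ?_
  split_ifs <;> simp_all [p.2.1]

theorem measurableSet_subset [Countable ι] (F : Set ι) : MeasurableSet {ω : Set ι | F ⊆ ω} := by
  have : {ω : Set ι | F ⊆ ω} = ⋂ i ∈ F, {ω | i ∈ ω} := by
    ext; simp [Set.subset_def]
  rw [this]
  exact MeasurableSet.biInter F.to_countable fun i _ => by measurability

theorem measurableSet_disjoint [Countable ι] (F : Set ι) :
    MeasurableSet {ω : Set ι | Disjoint ω F} := by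
  have : {ω : Set ι | Disjoint ω F} = ⋂ i ∈ F, {ω | i ∈ ω}ᶜ := by
    ext; simp [Set.disjoint_right]
  rw [this]
  exact MeasurableSet.biInter F.to_countable fun i _ => by measurability

theorem measurable_union_const (F : Set ι) : Measurable fun ω : Set ι => ω ∪ F := by
  rw [measurable_set_iff]
  intro i
  by_cases hi : i ∈ F
  · simp only [Set.mem_union, hi, or_true]; exact measurable_const
  · simp only [Set.mem_union, hi, or_false]; fun_prop

/-- Insertion tolerance: forcing finitely many elements of `u` into the random set costs an
increasing event at most a factor `p` per element. -/
theorem real_mul_pow_le_of_monotone [Countable ι] {A : Set (Set ι)} (hA : MeasurableSet A)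
    (hmono : ∀ ω ω' : Set ι, ω ⊆ ω' → ω ∈ A → ω' ∈ A) (F : Finset ι) (hF : (F : Set ι) ⊆ u) :
    (setBernoulli u p).real A * (p : ℝ) ^ F.card ≤
      (setBernoulli u p).real (A ∩ {ω | (F : Set ι) ⊆ ω}) := by
  set A' : Set (Set ι) := (fun ω : Set ι => ω ∪ F) ⁻¹' A
  have hA' : MeasurableSet A' := measurable_union_const _ hA
  have hdet : DeterminedBy A' (F : Set ι)ᶜ := fun ω ω' h => by
    have : ω ∪ F = ω' ∪ F := by
      ext i
      by_cases hi : i ∈ (F : Set ι)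
      · simp [hi]
      · have := Set.ext_iff.1 h i
        simpa [hi] using this
    simp only [A', Set.mem_preimage, this]
  have hle : (setBernoulli u p).real A ≤ (setBernoulli u p).real A' :=
    measureReal_mono fun ω h => hmono _ _ Set.subset_union_left h
  have hind := real_inter_of_determinedBy (u := u) (p := p) hA' (measurableSet_subset (F : Set ι))
    hdet determinedBy_subset disjoint_compl_left
  rw [real_subset F hF] at hind
  calc _ ≤ (setBernoulli u p).real A' * (p : ℝ) ^ F.card := by
        gcongr
        exact pow_nonneg p.2.1 _
    _ = _ := hind.symm
    _ ≤ _ := by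
        refine measureReal_mono fun ω h => ?_
        have h1 : ω ∪ F ∈ A := h.1
        rw [Set.union_eq_left.2 h.2] at h1
        exact ⟨h1, h.2⟩

/-- The probability of an event determined by finitely many elements is continuous in `p`. -/
theorem continuous_real_of_determinedBy {A : Set (Set ι)} (F : Finset ι)
    (hA : DeterminedBy A (F : Set ι)) :
    Continuous fun p : unitInterval => (setBernoulli u p).real A := by
  classical
  have hdec : A = ⋃ η ∈ F.powerset.filter (fun η : Finset ι => (η : Set ι) ∈ A),
      {ω : Set ι | ∀ i ∈ F, (i ∈ ω ↔ i ∈ (η : Set ι))} := by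
    ext ω
    simp only [Set.mem_iUnion, Finset.mem_filter, Finset.mem_powerset, Set.mem_ofPred_eq,
      exists_prop]
    constructor
    · intro h
      refine ⟨F.filter (· ∈ ω), ⟨Finset.filter_subset _ _, ?_⟩, fun i hi => by simp [hi]⟩
      refine (hA _ _ ?_).1 h
      ext i; simp; tauto
    · rintro ⟨η, ⟨hηF, hη⟩, h⟩
      refine (hA _ _ ?_).1 hη
      ext i
      constructor
      · rintro ⟨h1, h2⟩; exact ⟨(h i h2).2 h1, h2⟩
      · rintro ⟨h1, h2⟩; exact ⟨(h i h2).1 h1, h2⟩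
  have hsum (p : unitInterval) : (setBernoulli u p).real A =
      ∑ η ∈ F.powerset.filter (fun η : Finset ι => (η : Set ι) ∈ A),
        ∏ i ∈ F, ((if i ∈ u ↔ i ∈ (η : Set ι) then (p : ℝ) else 0) +
          if i ∈ (η : Set ι) then 0 else (1 - p : ℝ)) := by
    conv_lhs => rw [hdec]
    rw [measureReal_biUnion_finset]
    · refine Finset.sum_congr rfl fun η _ => ?_
      rw [real_cylinder]
      refine Finset.prod_congr rfl fun i _ => ?_
      congr
    · intro η hη η' hη' hne
      refine Set.disjoint_left.2 fun ω h h' => hne ?_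
      simp only [Finset.coe_filter, Finset.mem_powerset, Set.mem_ofPred_eq] at hη hη'
      ext i
      constructor
      · intro hi; exact (h' i (hη.1 hi)).1 ((h i (hη.1 hi)).2 hi)
      · intro hi; exact (h i (hη'.1 hi)).1 ((h' i (hη'.1 hi)).2 hi)
    · intro η _; exact measurableSet_cylinder_mem F _
  simp_rw [hsum]
  refine continuous_finsetSum _ fun η _ => continuous_finsetProd _ fun i _ => ?_
  split_ifs <;> fun_prop

/-- A permutation of the elements that preserves `u` preserves the law of the random set. -/
theorem map_preimage_setBernoulli (e : ι ≃ ι) (he : ∀ i, e i ∈ u ↔ i ∈ u) :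
    (setBernoulli u p).map (fun ω => e ⁻¹' ω) = setBernoulli u p := by
  have hm : Measurable fun ω : Set ι => e ⁻¹' ω := by
    rw [measurable_set_iff]; intro i; simp only [Set.mem_preimage]; fun_prop
  have hs : Measurable (fun p : ι → Prop => {i | p i}) := MeasurableEquiv.setOfPred.measurable
  have h := Measure.infinitePi_map_piCongrLeft (μ := fun i : ι =>
    (unitInterval.toNNReal p • Measure.dirac (i ∈ u) +
      unitInterval.toNNReal (unitInterval.symm p) • Measure.dirac False : Measure Prop)) e.symm
  rw [setBernoulli_eq_map, Measure.map_map hm hs]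
  conv_rhs => rw [← h]
  rw [Measure.map_map hs (by fun_prop)]
  have h1 : (fun i : ι => (unitInterval.toNNReal p • Measure.dirac (e.symm i ∈ u) +
      unitInterval.toNNReal (unitInterval.symm p) • Measure.dirac False : Measure Prop)) =
      (fun i : ι => (unitInterval.toNNReal p • Measure.dirac (i ∈ u) +
      unitInterval.toNNReal (unitInterval.symm p) • Measure.dirac False : Measure Prop)) := by
    ext1 i
    rw [show (e.symm i ∈ u) = (i ∈ u) from propext (by rw [← he, e.apply_symm_apply])]
  rw [h1]
  congr 1
  ext q i
  obtain ⟨j, rfl⟩ := e.symm.surjective i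
  simp only [Function.comp_apply, Set.mem_preimage, Equiv.apply_symm_apply, Set.mem_ofPred_eq]
  rw [MeasurableEquiv.piCongrLeft_apply_apply e.symm]

/-- Independent events of probability at most `r` all happen with probability at most a power
of `r`. -/
theorem real_forall_lt_le_pow {A : ℕ → Set (Set ι)} {F : ℕ → Set ι}
    (hA : ∀ j, MeasurableSet (A j)) (hAF : ∀ j, DeterminedBy (A j) (F j))
    (hF : Pairwise fun i j => Disjoint (F i) (F j)) {r : ℝ} (hr0 : 0 ≤ r)
    (hr : ∀ j, (setBernoulli u p).real (A j) ≤ r) (k : ℕ) :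
    (setBernoulli u p).real {ω | ∀ j < k, ω ∈ A j} ≤ r ^ k := by
  induction k with
  | zero => simp
  | succ k ih =>
    have hset : {ω : Set ι | ∀ j < k + 1, ω ∈ A j} = {ω | ∀ j < k, ω ∈ A j} ∩ A k := by
      ext ω
      simp only [Set.mem_inter_iff, Set.mem_ofPred_eq, Nat.forall_lt_succ_right]
    have hset2 : {ω : Set ι | ∀ j < k, ω ∈ A j} = ⋂ j, ⋂ (_ : j < k), A j := by
      ext ω; simp
    rw [hset, real_inter_of_determinedBy (F := ⋃ j, ⋃ (_ : j < k), F j) (F' := F k), pow_succ]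
    · exact mul_le_mul ih (hr k) measureReal_nonneg (pow_nonneg hr0 _)
    · rw [hset2]
      exact .iInter fun j => .iInter fun _ => hA j
    · exact hA k
    · rw [hset2]
      exact .iInter fun j => .iInter fun hj => (hAF j).mono
        (Set.subset_iUnion₂_of_subset j hj subset_rfl)
    · exact hAF k
    · simp only [Set.disjoint_iUnion_left]
      exact fun j hj => hF hj.ne

/-- If the finite sets `F j` are pairwise disjoint and of bounded size, the random set is unlikely
to meet the first `k` of them all. -/
theorem real_forall_not_disjoint_le [Countable ι] (F : ℕ → Finset ι)
    (hF : Pairwise fun i j => Disjoint (F i : Set ι) (F j)) (K : ℕ) (hK : ∀ j, (F j).card ≤ K)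
    (k : ℕ) : (setBernoulli u p).real {ω | ∀ j < k, ¬ Disjoint ω (F j : Set ι)} ≤
      (1 - (1 - p : ℝ) ^ K) ^ k := by
  have hp0 : (0 : ℝ) ≤ 1 - p := by linarith [p.2.2]
  have hp1 : (1 - p : ℝ) ≤ 1 := by linarith [p.2.1]
  refine real_forall_lt_le_pow (A := fun j => {ω | Disjoint ω (F j : Set ι)}ᶜ)
    (F := fun j => (F j : Set ι)) (fun j => (measurableSet_disjoint _).compl)
    (fun j => determinedBy_disjoint.compl) hF (sub_nonneg.2 (pow_le_one₀ hp0 hp1)) (fun j => ?_) k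
  rw [probReal_compl_eq_one_sub (measurableSet_disjoint _)]
  have := pow_card_le_real_disjoint (u := u) (p := p) (F j)
  have := pow_le_pow_of_le_one hp0 hp1 (hK j)
  linarith

/-- Bonferroni's lower bound for the probability of a union. -/
theorem sum_real_sub_le_real_biUnion {Ω κ : Type*} [MeasurableSpace Ω] {μ : Measure Ω}
    [IsProbabilityMeasure μ] {A : κ → Set Ω} (hA : ∀ i, MeasurableSet (A i)) {δ : ℝ} (hδ : 0 ≤ δ)
    (s : Finset κ) (h : ∀ i ∈ s, ∀ j ∈ s, i ≠ j → μ.real (A i ∩ A j) ≤ δ) :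
    ∑ i ∈ s, μ.real (A i) - (s.card : ℝ) ^ 2 * δ ≤ μ.real (⋃ i ∈ s, A i) := by
  classical
  induction s using Finset.induction_on with
  | empty => simp
  | insert a s ha ih =>
    have ih' := ih fun i hi j hj =>
      h i (Finset.mem_insert_of_mem hi) j (Finset.mem_insert_of_mem hj)
    have hu := measureReal_union_add_inter (μ := μ) (s := A a) (t := ⋃ i ∈ s, A i)
      (Finset.measurableSet_biUnion _ fun i _ => hA i) (measure_ne_top _ _) (measure_ne_top _ _)
    have hi : μ.real (A a ∩ ⋃ i ∈ s, A i) ≤ s.card * δ := by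
      rw [Set.inter_iUnion₂]
      refine (measureReal_biUnion_finset_le _ _).trans ?_
      rw [← nsmul_eq_mul]
      refine Finset.sum_le_card_nsmul _ _ _ fun i hi => ?_
      exact h a (Finset.mem_insert_self _ _) i (Finset.mem_insert_of_mem hi) (by grind)
    rw [Finset.set_biUnion_insert, Finset.sum_insert ha, Finset.card_insert_of_notMem ha]
    push_cast
    have : 0 ≤ (s.card : ℝ) * δ := by positivity
    nlinarith

end ProbabilityTheory

/-! ### Connection events and genealogies -/

namespace SimpleGraph

variable {V : Type*} {G : SimpleGraph V}

/-- The event that `x` and `y` are joined by a path of open edges lying in `F`. -/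
def connEvent (F : Set (Sym2 V)) (x y : V) : Set (Set (Sym2 V)) :=
  {ω | (fromEdgeSet (ω ∩ F)).Reachable x y}

section connEvent

variable {F F' : Set (Sym2 V)} {ω ω' : Set (Sym2 V)} {x y z : V}

theorem mem_connEvent_of_subset (h : ω ∩ F ⊆ ω' ∩ F') (hω : ω ∈ connEvent F x y) :
    ω' ∈ connEvent F' x y :=
  Reachable.mono (fromEdgeSet_mono h) hω

theorem connEvent_mono (h : F ⊆ F') : connEvent F x y ⊆ connEvent F' x y := fun _ hω =>
  mem_connEvent_of_subset (Set.inter_subset_inter_right _ h) hω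

theorem connEvent_trans (h : ω ∈ connEvent F x y) (h' : ω ∈ connEvent F y z) :
    ω ∈ connEvent F x z :=
  Reachable.trans h h'

theorem connEvent_symm (h : ω ∈ connEvent F x y) : ω ∈ connEvent F y x :=
  Reachable.symm h

theorem connEvent_refl : ω ∈ connEvent F x x := Reachable.refl _

theorem mem_connEvent_of_mem (h : s(x, y) ∈ ω) (h' : s(x, y) ∈ F) : ω ∈ connEvent F x y := by
  by_cases hxy : x = y
  · subst hxy; exact connEvent_refl
  · exact Adj.reachable ((fromEdgeSet_adj _).2 ⟨⟨h, h'⟩, hxy⟩)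

theorem determinedBy_connEvent : DeterminedBy (connEvent F x y) F :=
  .of_inter_iff fun ω => by
    simp only [connEvent, Set.mem_ofPred_eq, Set.inter_assoc, Set.inter_self]

/-- If `P` holds at `x` and is preserved by the open edges in `F`, it holds on the cluster
of `x`. -/
theorem connEvent_induction {P : V → Prop} (h : ω ∈ connEvent F x y) (hx : P x)
    (hP : ∀ u v, P u → s(u, v) ∈ ω → s(u, v) ∈ F → u ≠ v → P v) : P y := by
  have h' : Relation.ReflTransGen (fromEdgeSet (ω ∩ F)).Adj x y :=
    (reachable_iff_reflTransGen _ _).1 h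
  induction h' with
  | refl => exact hx
  | tail _ h2 ih =>
    have h3 := (fromEdgeSet_adj _).1 h2
    exact hP _ _ (ih ((reachable_iff_reflTransGen _ _).2 ‹_›)) h3.1.1 h3.1.2 h3.2

theorem measurableSet_connEvent [Countable V] : MeasurableSet (connEvent F x y) := by
  classical
  -- `R n y` is the event that `y` can be reached from `x` in `n` steps along open edges of `F`.
  let R : ℕ → V → Set (Set (Sym2 V)) := fun n => n.rec (fun y => {_ω | x = y})
    fun _ A y => ⋃ z, A z ∩ {ω | s(z, y) ∈ ω ∩ F ∧ z ≠ y}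
  have hR (n : ℕ) : ∀ y, MeasurableSet (R n y) := by
    induction n with
    | zero => exact fun y => MeasurableSet.const _
    | succ n ih =>
      refine fun y => MeasurableSet.iUnion fun z => (ih z).inter ?_
      exact ((measurableSet_mem (s(z, y))).inter (MeasurableSet.const (s(z, y) ∈ F))).inter
        (MeasurableSet.const (z ≠ y))
  have : connEvent F x y = ⋃ n, R n y := by
    ext ω
    simp only [Set.mem_iUnion]
    constructor
    · intro h
      have h' : Relation.ReflTransGen (fromEdgeSet (ω ∩ F)).Adj x y :=
        (reachable_iff_reflTransGen _ _).1 h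
      clear h
      induction h' with
      | refl => exact ⟨0, rfl⟩
      | tail _ h2 ih =>
        obtain ⟨n, hn⟩ := ih
        exact ⟨n + 1, Set.mem_iUnion.2 ⟨_, hn, (fromEdgeSet_adj _).1 h2⟩⟩
    · rintro ⟨n, hn⟩
      induction n generalizing y with
      | zero =>
        have : x = y := hn
        subst this
        exact connEvent_refl
      | succ n ih =>
        obtain ⟨z, hz, hzy, hne⟩ := Set.mem_iUnion.1 hn
        exact connEvent_trans (ih hz) (mem_connEvent_of_mem hzy.1 hzy.2)
  rw [this]
  exact MeasurableSet.iUnion fun n => hR n y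

theorem preimage_mem_connEvent_iff (g : V ≃ V) :
    Sym2.map g ⁻¹' ω ∈ connEvent (Sym2.map g ⁻¹' F) x y ↔ ω ∈ connEvent F (g x) (g y) := by
  let φ : fromEdgeSet (Sym2.map g ⁻¹' ω ∩ Sym2.map g ⁻¹' F) ≃g fromEdgeSet (ω ∩ F) :=
    { g with map_rel_iff' := by intro a b; simp }
  exact (φ.reachable_iff (u := x) (v := y)).symm

theorem measurableSet_infinite_connEvent [Countable V] :
    MeasurableSet {ω | {y | ω ∈ connEvent F x y}.Infinite} := by
  have : Measurable fun ω => {y | ω ∈ connEvent F x y} := by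
    rw [measurable_set_iff]
    intro y
    exact measurable_mem.2 measurableSet_connEvent
  exact this MeasurableSet.setOfPred_infinite

end connEvent

/-- An automorphism of `G` preserves the law of percolation. -/
theorem percolation_real_preimage_map (p : unitInterval) (g : G ≃g G) (A : Set (Set (Sym2 V)))
    (hA : MeasurableSet A) :
    (G.percolation p).real {ω | Sym2.map g ⁻¹' ω ∈ A} = (G.percolation p).real A := by
  let e : Sym2 V ≃ Sym2 V :=
    { toFun := Sym2.map g
      invFun := Sym2.map g.symm
      left_inv := fun a => by rw [Sym2.map_map]; simp
      right_inv := fun a => by rw [Sym2.map_map]; simp }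
  have h := map_preimage_setBernoulli (u := G.edgeSet) (p := p) e (by
    intro a
    induction a with | _ a b => exact g.map_adj_iff)
  have hm : Measurable fun ω : Set (Sym2 V) => e ⁻¹' ω := by
    rw [measurable_set_iff]; intro i; simp only [Set.mem_preimage]; fun_prop
  have := congrArg (fun μ : Measure (Set (Sym2 V)) => μ.real A) h
  simp only [map_measureReal_apply hm hA] at this
  exact this

instance (p : unitInterval) : IsProbabilityMeasure (G.percolation p) := by
  unfold percolation; infer_instance

/-- A decorated tree seen from its distinguished end: every vertex has a parent (the next vertex
towards the end), the automorphisms that respect parents act transitively, and any two vertices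
have a common ancestor. The Busemann function `height` grows by one from parent to child. -/
structure Genealogy (G : SimpleGraph V) where
  /-- the neighbour in the tree in the direction of the end -/
  parent : V → V
  /-- the Busemann function of the end -/
  height : V → ℤ
  height_parent : ∀ x, height (parent x) = height x - 1
  adj_parent : ∀ x, G.Adj x (parent x)
  exists_common : ∀ x y, ∃ a b, parent^[a] x = parent^[b] y
  finite_neighbors : ∀ x, (G.neighborSet x).Finite
  exists_children : ∀ x, ∃ y z, y ≠ z ∧ parent y = x ∧ parent z = x
  homogeneous : ∀ u v, ∃ g : G ≃g G, (∀ x, g (parent x) = parent (g x)) ∧ g u = v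

namespace Genealogy

variable (𝒢 : Genealogy G)

/-- The descendants of `x`, including `x` itself. -/
def desc (x : V) : Set V := {y | ∃ k, 𝒢.parent^[k] y = x}

/-- The `n`-th generation of descendants of `x`. -/
def gen (n : ℕ) (x : V) : Set V := {y | 𝒢.parent^[n] y = x}

variable {𝒢} {x y z u v : V} {n k : ℕ}

theorem height_iterate (k : ℕ) (x : V) : 𝒢.height (𝒢.parent^[k] x) = 𝒢.height x - k := by
  induction k with
  | zero => simp
  | succ k ih =>
    rw [Function.iterate_succ_apply', 𝒢.height_parent, ih]; push_cast; ring

theorem self_mem_desc : x ∈ 𝒢.desc x := ⟨0, rfl⟩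

theorem mem_desc_iterate (k : ℕ) (x : V) : x ∈ 𝒢.desc (𝒢.parent^[k] x) := ⟨k, rfl⟩

theorem desc_subset (h : y ∈ 𝒢.desc x) : 𝒢.desc y ⊆ 𝒢.desc x := by
  rintro z ⟨k, rfl⟩
  obtain ⟨j, rfl⟩ := h
  exact ⟨j + k, Function.iterate_add_apply _ _ _ _⟩

theorem height_le_of_mem_desc (h : y ∈ 𝒢.desc x) : 𝒢.height x ≤ 𝒢.height y := by
  obtain ⟨k, rfl⟩ := h
  rw [height_iterate]; omega

theorem mem_gen_iff : y ∈ 𝒢.gen n x ↔ y ∈ 𝒢.desc x ∧ 𝒢.height y = 𝒢.height x + n := by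
  constructor
  · rintro rfl
    exact ⟨⟨n, rfl⟩, by rw [height_iterate]; ring⟩
  · rintro ⟨⟨k, rfl⟩, h⟩
    rw [height_iterate] at h
    have : k = n := by omega
    subst this; rfl

theorem gen_subset_desc : 𝒢.gen n x ⊆ 𝒢.desc x := fun _ h => (mem_gen_iff.1 h).1

theorem iterate_mem_desc (h : y ∈ 𝒢.desc x) (hk : 𝒢.height x + k ≤ 𝒢.height y) :
    𝒢.parent^[k] y ∈ 𝒢.desc x := by
  obtain ⟨j, rfl⟩ := h
  rw [height_iterate] at hk
  obtain ⟨i, rfl⟩ : ∃ i, j = i + k := ⟨j - k, by omega⟩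
  exact ⟨i, (Function.iterate_add_apply _ _ _ _).symm⟩

theorem eq_of_mem_desc (hu : z ∈ 𝒢.desc x) (hv : z ∈ 𝒢.desc y)
    (h : 𝒢.height x = 𝒢.height y) : x = y := by
  obtain ⟨j, rfl⟩ := hu
  obtain ⟨k, rfl⟩ := hv
  rw [height_iterate, height_iterate] at h
  have : j = k := by omega
  rw [this]

theorem gen_zero : 𝒢.gen 0 x = {x} := by
  ext y; simp [gen]

theorem gen_succ : 𝒢.gen (n + 1) x = ⋃ y ∈ 𝒢.gen n x, 𝒢.gen 1 y := by
  ext z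
  simp only [gen, Set.mem_ofPred_eq, Set.mem_iUnion, Function.iterate_one, exists_prop]
  rw [Function.iterate_succ_apply]
  exact ⟨fun h => ⟨_, h, rfl⟩, fun ⟨y, h, h'⟩ => h' ▸ h⟩

theorem finite_gen (𝒢 : Genealogy G) (n : ℕ) (x : V) : (𝒢.gen n x).Finite := by
  induction n with
  | zero => rw [gen_zero]; exact Set.finite_singleton x
  | succ n ih =>
    rw [gen_succ]
    refine ih.biUnion fun y _ => (𝒢.finite_neighbors y).subset fun z hz => ?_
    have hz' : 𝒢.parent z = y := hz
    exact hz' ▸ (𝒢.adj_parent z).symm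

theorem countable (𝒢 : Genealogy G) : Countable V := by
  by_cases hV : Nonempty V
  · obtain ⟨o⟩ := hV
    have : (Set.univ : Set V) = ⋃ a : ℕ, ⋃ b : ℕ, 𝒢.gen b (𝒢.parent^[a] o) := by
      refine (Set.eq_univ_of_forall fun x => ?_).symm
      obtain ⟨a, b, h⟩ := 𝒢.exists_common o x
      simp only [Set.mem_iUnion]
      exact ⟨a, b, h.symm⟩
    rw [← Set.countable_univ_iff, this]
    exact Set.countable_iUnion fun a => Set.countable_iUnion fun b => (𝒢.finite_gen _ _).countable
  · rw [not_nonempty_iff] at hV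
    infer_instance

section automorphism

variable {g : G ≃g G} (hg : ∀ x, g (𝒢.parent x) = 𝒢.parent (g x))
include hg

theorem map_iterate (k : ℕ) (x : V) : g (𝒢.parent^[k] x) = 𝒢.parent^[k] (g x) := by
  induction k with
  | zero => rfl
  | succ k ih => rw [Function.iterate_succ_apply', hg, ih, Function.iterate_succ_apply']

theorem map_mem_desc_iff : g y ∈ 𝒢.desc (g x) ↔ y ∈ 𝒢.desc x := by
  refine exists_congr fun k => ?_
  rw [← map_iterate hg]
  exact g.injective.eq_iff

theorem map_mem_gen_iff : g y ∈ 𝒢.gen n (g x) ↔ y ∈ 𝒢.gen n x := by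
  simp only [gen, Set.mem_ofPred_eq]
  rw [← map_iterate hg]
  exact g.injective.eq_iff

theorem height_map_sub (x y : V) :
    𝒢.height (g x) - 𝒢.height (g y) = 𝒢.height x - 𝒢.height y := by
  obtain ⟨a, b, h⟩ := 𝒢.exists_common x y
  have h1 := congrArg 𝒢.height h
  have h2 := congrArg (fun z => 𝒢.height (g z)) h
  simp only [map_iterate hg, height_iterate] at h1 h2
  omega

end automorphism

/-- Edges join vertices that have a common ancestor at bounded distance: this holds for the finitely
many edges at one vertex, and the automorphisms carry it to all the others. -/
theorem exists_range (𝒢 : Genealogy G) : ∃ M : ℕ, ∀ u v, G.Adj u v →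
    ∃ a b, a ≤ M ∧ b ≤ M ∧ 𝒢.parent^[a] u = 𝒢.parent^[b] v := by
  by_cases hV : Nonempty V
  · obtain ⟨o⟩ := hV
    choose a b hab using 𝒢.exists_common o
    obtain ⟨M, hM⟩ := ((𝒢.finite_neighbors o).image fun v => max (a v) (b v)).bddAbove
    refine ⟨M, fun u v huv => ?_⟩
    obtain ⟨g, hg, hgo⟩ := 𝒢.homogeneous u o
    have hadj : G.Adj o (g v) := by rw [← hgo]; exact g.map_adj_iff.2 huv
    have hle : max (a (g v)) (b (g v)) ≤ M := hM ⟨g v, hadj, rfl⟩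
    refine ⟨a (g v), b (g v), (le_max_left _ _).trans hle, (le_max_right _ _).trans hle,
      g.injective ?_⟩
    rw [map_iterate hg, map_iterate hg, hgo]
    exact hab (g v)
  · exact ⟨0, fun u => (hV ⟨u⟩).elim⟩

/-- The range of `𝒢`: a fixed upper bound for how far back one has to go from the ends of an edge
to reach a common ancestor. -/
noncomputable def range (𝒢 : Genealogy G) : ℕ := 𝒢.exists_range.choose

theorem exists_common_of_adj (h : G.Adj u v) :
    ∃ a b, a ≤ 𝒢.range ∧ b ≤ 𝒢.range ∧ 𝒢.parent^[a] u = 𝒢.parent^[b] v :=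
  𝒢.exists_range.choose_spec u v h

theorem height_le_add_range (h : G.Adj u v) : 𝒢.height v ≤ 𝒢.height u + 𝒢.range := by
  obtain ⟨a, b, ha, hb, hab⟩ := exists_common_of_adj (𝒢 := 𝒢) h
  have := congrArg 𝒢.height hab
  rw [height_iterate, height_iterate] at this
  omega

/-- The edges of `G` inside the descendants of `x`. -/
def inner (𝒢 : Genealogy G) (x : V) : Set (Sym2 V) :=
  {e | e ∈ G.edgeSet ∧ ∀ v ∈ e, v ∈ 𝒢.desc x}

/-- The edges of `G` inside the descendants of `x` that have an end before generation `n`. -/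
def upper (𝒢 : Genealogy G) (n : ℕ) (x : V) : Set (Sym2 V) :=
  {e | e ∈ 𝒢.inner x ∧ ∃ v ∈ e, 𝒢.height v < 𝒢.height x + n}

theorem upper_subset_inner : 𝒢.upper n x ⊆ 𝒢.inner x := fun _ h => h.1

theorem inner_subset_edgeSet : 𝒢.inner x ⊆ G.edgeSet := fun _ h => h.1

theorem inner_subset_inner (h : y ∈ 𝒢.desc x) : 𝒢.inner y ⊆ 𝒢.inner x :=
  fun _ he => ⟨he.1, fun v hv => desc_subset h (he.2 v hv)⟩

theorem upper_mono {m : ℕ} (h : n ≤ m) : 𝒢.upper n x ⊆ 𝒢.upper m x := fun _ he => by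
  obtain ⟨v, hv, hv'⟩ := he.2
  exact ⟨he.1, v, hv, by omega⟩

theorem disjoint_upper_inner (h : y ∈ 𝒢.gen n x) : Disjoint (𝒢.upper n x) (𝒢.inner y) := by
  refine Set.disjoint_left.2 fun e he he' => ?_
  obtain ⟨v, hv, hv'⟩ := he.2
  have := height_le_of_mem_desc (he'.2 v hv)
  have := (mem_gen_iff.1 h).2
  omega

theorem disjoint_inner (h : Disjoint (𝒢.desc x) (𝒢.desc y)) :
    Disjoint (𝒢.inner x) (𝒢.inner y) := by
  refine Set.disjoint_left.2 fun e he he' => ?_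
  induction e with
  | _ a b => exact Set.disjoint_left.1 h (he.2 a (by simp)) (he'.2 a (by simp))

theorem finite_incident (𝒢 : Genealogy G) (x : V) : {e | e ∈ G.edgeSet ∧ x ∈ e}.Finite := by
  refine ((𝒢.finite_neighbors x).image fun y => s(x, y)).subset ?_
  rintro e ⟨he, hx⟩
  obtain ⟨y, rfl⟩ := Sym2.mem_iff_exists.1 hx
  exact ⟨y, he, rfl⟩

theorem finite_upper (𝒢 : Genealogy G) (n : ℕ) (x : V) : (𝒢.upper n x).Finite := by
  refine ((Set.finite_lt_nat n).biUnion fun j _ => (𝒢.finite_gen j x).biUnion fun v _ =>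
    𝒢.finite_incident v).subset ?_
  rintro e ⟨he, v, hv, hv'⟩
  obtain ⟨k, hk⟩ := he.2 v hv
  simp only [Set.mem_iUnion]
  refine ⟨k, ?_, v, hk, he.1, hv⟩
  rw [← hk, height_iterate] at hv'
  simp only [Set.mem_ofPred_eq]
  omega

section automorphism

variable {g : G ≃g G} (hg : ∀ x, g (𝒢.parent x) = 𝒢.parent (g x))
include hg

theorem preimage_inner : Sym2.map g ⁻¹' 𝒢.inner (g x) = 𝒢.inner x := by
  ext e
  induction e with
  | _ a b =>
    have := g.map_adj_iff (v := a) (w := b)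
    simp [inner, map_mem_desc_iff hg, this]

theorem preimage_upper : Sym2.map g ⁻¹' 𝒢.upper n (g x) = 𝒢.upper n x := by
  ext e
  have h := Set.ext_iff.1 (preimage_inner (𝒢 := 𝒢) (x := x) hg) e
  have h1 (a : V) : 𝒢.height (g a) < 𝒢.height (g x) + n ↔ 𝒢.height a < 𝒢.height x + n := by
    have := height_map_sub hg a x
    omega
  induction e with
  | _ a b =>
    refine and_congr h ?_
    simp [h1]

end automorphism

end Genealogy

end SimpleGraph

/-! ### The embedded branching process -/

namespace SimpleGraph

namespace Genealogy

variable {V : Type*} {G : SimpleGraph V} {𝒢 : Genealogy G} {x y z : V} {n k : ℕ}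
  {p : unitInterval}

/-- The expected number of members of generation `n` of `x` that are joined to `x` through
`𝒢.upper n x`. -/
noncomputable def meanOffspring (𝒢 : Genealogy G) (n : ℕ) (x : V) (p : unitInterval) : ℝ :=
  ∑ y ∈ (𝒢.finite_gen n x).toFinset, (G.percolation p).real (connEvent (𝒢.upper n x) x y)

/-- The event that the branching process embedded in the cluster of `x`, in which the offspring of
`y` are the members of generation `n` of `y` joined to `y` through `𝒢.upper n y`, survives for `k`
steps. -/
def survive (𝒢 : Genealogy G) (n : ℕ) : ℕ → V → Set (Set (Sym2 V))
  | 0, _ => Set.univ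
  | k + 1, x => ⋃ y ∈ (𝒢.finite_gen n x).toFinset,
      connEvent (𝒢.upper n x) x y ∩ survive 𝒢 n k y

/-- The event that the cluster of `x` inside the descendants of `x` is infinite. -/
def infiniteBelow (𝒢 : Genealogy G) (x : V) : Set (Set (Sym2 V)) :=
  {ω | {y | ω ∈ connEvent (𝒢.inner x) x y}.Infinite}

theorem measurableSet_infiniteBelow : MeasurableSet (𝒢.infiniteBelow x) :=
  have := 𝒢.countable
  measurableSet_infinite_connEvent

theorem determinedBy_infiniteBelow : DeterminedBy (𝒢.infiniteBelow x) (𝒢.inner x) :=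
  .of_inter_iff fun ω => by
    simp only [infiniteBelow, Set.mem_ofPred_eq, determinedBy_connEvent.inter_mem_iff]

theorem measurableSet_survive : MeasurableSet (𝒢.survive n k x) := by
  have := 𝒢.countable
  induction k generalizing x with
  | zero => exact MeasurableSet.univ
  | succ k ih =>
    exact Finset.measurableSet_biUnion _ fun y _ => measurableSet_connEvent.inter ih

theorem determinedBy_survive : DeterminedBy (𝒢.survive n k x) (𝒢.inner x) := by
  induction k generalizing x with
  | zero => exact fun _ _ _ => Iff.rfl
  | succ k ih =>
    refine .iUnion fun y => .iUnion fun hy => .inter ?_ ?_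
    · exact determinedBy_connEvent.mono upper_subset_inner
    · exact ih.mono (inner_subset_inner (gen_subset_desc (by simpa using hy)))

theorem survive_succ_subset : 𝒢.survive n (k + 1) x ⊆ 𝒢.survive n k x := by
  induction k generalizing x with
  | zero => exact Set.subset_univ _
  | succ k ih =>
    exact Set.iUnion₂_mono fun y _ => Set.inter_subset_inter_right _ ih

section automorphism

variable {g : G ≃g G} (hg : ∀ x, g (𝒢.parent x) = 𝒢.parent (g x))
include hg

theorem preimage_mem_connEvent_upper_iff {ω : Set (Sym2 V)} :
    Sym2.map g ⁻¹' ω ∈ connEvent (𝒢.upper n x) x y ↔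
      ω ∈ connEvent (𝒢.upper n (g x)) (g x) (g y) := by
  rw [← preimage_upper (g := g) hg]
  exact preimage_mem_connEvent_iff g.toEquiv

theorem preimage_mem_survive_iff {ω : Set (Sym2 V)} :
    Sym2.map g ⁻¹' ω ∈ 𝒢.survive n k x ↔ ω ∈ 𝒢.survive n k (g x) := by
  induction k generalizing x with
  | zero => exact Iff.rfl
  | succ k ih =>
    simp only [survive, Set.mem_iUnion, Set.mem_inter_iff, Set.Finite.mem_toFinset, exists_prop]
    refine Iff.trans ?_ g.surjective.exists.symm
    refine exists_congr fun y => ?_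
    rw [map_mem_gen_iff hg, preimage_mem_connEvent_upper_iff hg, ih]

theorem survive_map :
    (G.percolation p).real (𝒢.survive n k (g x)) = (G.percolation p).real (𝒢.survive n k x) := by
  rw [← percolation_real_preimage_map p g (𝒢.survive n k x) measurableSet_survive]
  simp only [preimage_mem_survive_iff hg, Set.ofPred_mem_eq]

theorem meanOffspring_map : 𝒢.meanOffspring n (g x) p = 𝒢.meanOffspring n x p := by
  have := 𝒢.countable
  refine (Finset.sum_equiv g.toEquiv (fun y => ?_) fun y _ => ?_).symm
  · simp only [Set.Finite.mem_toFinset]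
    exact (map_mem_gen_iff hg).symm
  · rw [← percolation_real_preimage_map p g _ measurableSet_connEvent]
    simp only [preimage_mem_connEvent_upper_iff hg]
    rfl

end automorphism

theorem survive_eq (x y : V) :
    (G.percolation p).real (𝒢.survive n k x) = (G.percolation p).real (𝒢.survive n k y) := by
  obtain ⟨g, hg, rfl⟩ := 𝒢.homogeneous x y
  exact (survive_map hg).symm

theorem meanOffspring_eq (x y : V) : 𝒢.meanOffspring n x p = 𝒢.meanOffspring n y p := by
  obtain ⟨g, hg, rfl⟩ := 𝒢.homogeneous x y
  exact (meanOffspring_map hg).symm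

theorem real_connEvent_inter_survive (hy : y ∈ 𝒢.gen n x) :
    (G.percolation p).real (connEvent (𝒢.upper n x) x y ∩ 𝒢.survive n k y) =
      (G.percolation p).real (connEvent (𝒢.upper n x) x y) *
        (G.percolation p).real (𝒢.survive n k y) :=
  have := 𝒢.countable
  real_inter_of_determinedBy measurableSet_connEvent measurableSet_survive determinedBy_connEvent
    determinedBy_survive (disjoint_upper_inner hy)

theorem disjoint_desc (h : 𝒢.height x = 𝒢.height y) (hne : x ≠ y) :
    Disjoint (𝒢.desc x) (𝒢.desc y) :=
  Set.disjoint_left.2 fun _ hx hy => hne (eq_of_mem_desc hx hy h)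

/-- The recursive lower bound for the survival probability, from Bonferroni's inequality. -/
theorem mul_sub_le_survive_succ (n k : ℕ) (x : V) :
    𝒢.meanOffspring n x p * (G.percolation p).real (𝒢.survive n k x) -
        ((𝒢.finite_gen n x).toFinset.card : ℝ) ^ 2 *
          (G.percolation p).real (𝒢.survive n k x) ^ 2 ≤
      (G.percolation p).real (𝒢.survive n (k + 1) x) := by
  have := 𝒢.countable
  have h := sum_real_sub_le_real_biUnion (μ := G.percolation p)
    (A := fun y => connEvent (𝒢.upper n x) x y ∩ 𝒢.survive n k y)
    (δ := (G.percolation p).real (𝒢.survive n k x) ^ 2)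
    (fun y => measurableSet_connEvent.inter measurableSet_survive) (by positivity)
    (𝒢.finite_gen n x).toFinset (fun y hy z hz hyz => by
      simp only [Set.Finite.mem_toFinset] at hy hz
      calc _ ≤ (G.percolation p).real (𝒢.survive n k y ∩ 𝒢.survive n k z) :=
            measureReal_mono fun ω hω => ⟨hω.1.2, hω.2.2⟩
        _ = (G.percolation p).real (𝒢.survive n k y) *
              (G.percolation p).real (𝒢.survive n k z) := by
            refine real_inter_of_determinedBy measurableSet_survive measurableSet_survive
              determinedBy_survive determinedBy_survive (disjoint_inner (disjoint_desc ?_ hyz))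
            rw [(mem_gen_iff.1 hy).2, (mem_gen_iff.1 hz).2]
        _ ≤ _ := by rw [survive_eq y x, survive_eq z x, sq])
  refine le_trans (le_of_eq ?_) h
  congr 1
  rw [meanOffspring, Finset.sum_mul]
  refine Finset.sum_congr rfl fun y hy => ?_
  rw [real_connEvent_inter_survive (by simpa using hy), survive_eq y x]

/-- If the embedded branching process has more than one child on average, its survival probability
is bounded below. -/
theorem exists_le_survive (hm : ∀ x, 1 < 𝒢.meanOffspring n x p) :
    ∃ ε : ℝ, 0 < ε ∧ ε ≤ 1 ∧ ∀ k x, ε ≤ (G.percolation p).real (𝒢.survive n k x) := by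
  by_cases hV : Nonempty V
  swap
  · exact ⟨1, one_pos, le_rfl, fun _ x => (hV ⟨x⟩).elim⟩
  obtain ⟨o⟩ := hV
  obtain ⟨y, hy, hc⟩ : ∃ y ∈ (𝒢.finite_gen n o).toFinset,
      0 < (G.percolation p).real (connEvent (𝒢.upper n o) o y) := by
    refine Finset.exists_lt_of_sum_lt (f := fun _ => (0 : ℝ)) ?_
    have := hm o
    rw [meanOffspring] at this
    simp only [Finset.sum_const_zero]
    linarith
  set c := (G.percolation p).real (connEvent (𝒢.upper n o) o y)
  set m := 𝒢.meanOffspring n o p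
  set N : ℝ := ((𝒢.finite_gen n o).toFinset.card : ℝ)
  have hN : 0 < N ^ 2 := by
    have : 0 < (𝒢.finite_gen n o).toFinset.card := Finset.card_pos.2 ⟨y, hy⟩
    positivity
  have hm1 : 0 < m - 1 := sub_pos.2 (hm o)
  set δ := (m - 1) / N ^ 2
  have hδ : 0 < δ := by positivity
  refine ⟨min 1 (c * δ), by positivity, min_le_left _ _, fun k x => ?_⟩
  rw [survive_eq x o]
  induction k with
  | zero => simp [survive]
  | succ k ih =>
    set s := (G.percolation p).real (𝒢.survive n k o)
    have hs : 0 ≤ s := measureReal_nonneg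
    -- For `s ≤ δ` the Bonferroni bound gives `s ≤ s_{k+1}`. For larger `s` that bound is useless,
    -- but survival through the single vertex `y` already has probability at least `c * δ`.
    rcases le_total s δ with h | h
    · refine ih.trans (le_trans ?_ (mul_sub_le_survive_succ n k o))
      have h1 : N ^ 2 * s ≤ m - 1 := by
        rw [mul_comm]; exact (le_div_iff₀ hN).1 h
      change s ≤ m * s - N ^ 2 * s ^ 2
      nlinarith
    · refine (min_le_right _ _).trans ?_
      calc c * δ ≤ c * s := by gcongr
        _ = (G.percolation p).real (connEvent (𝒢.upper n o) o y ∩ 𝒢.survive n k y) := by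
            rw [real_connEvent_inter_survive (by simpa using hy), survive_eq y o]
        _ ≤ _ := measureReal_mono (fun ω hω => Set.mem_iUnion₂.2 ⟨y, hy, hω⟩)
            (measure_ne_top _ _)

theorem exists_connEvent_of_mem_survive {ω : Set (Sym2 V)} (h : ω ∈ 𝒢.survive n k x) :
    ∃ y ∈ 𝒢.gen (n * k) x, ω ∈ connEvent (𝒢.inner x) x y := by
  induction k generalizing x with
  | zero => exact ⟨x, by simp [gen_zero], connEvent_refl⟩
  | succ k ih =>
    simp only [survive, Set.mem_iUnion, Set.Finite.mem_toFinset] at h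
    obtain ⟨y, hy, hxy, hsurv⟩ := h
    obtain ⟨z, hz, hyz⟩ := ih hsurv
    refine ⟨z, ?_, connEvent_trans (connEvent_mono upper_subset_inner hxy)
      (connEvent_mono (inner_subset_inner (gen_subset_desc hy)) hyz)⟩
    have hy' : 𝒢.parent^[n] y = x := hy
    have hz' : 𝒢.parent^[n * k] z = y := hz
    change 𝒢.parent^[n * (k + 1)] z = x
    rw [show n * (k + 1) = n + n * k by ring, Function.iterate_add_apply, hz', hy']

theorem iInter_survive_subset (hn : n ≠ 0) : ⋂ k, 𝒢.survive n k x ⊆ 𝒢.infiniteBelow x := by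
  intro ω hω
  rw [Set.mem_iInter] at hω
  choose y hy hxy using fun k => exists_connEvent_of_mem_survive (hω k)
  refine Set.infinite_of_injective_forall_mem (f := y) (fun i j hij => ?_) hxy
  have h1 := (mem_gen_iff.1 (hy i)).2
  have h2 := (mem_gen_iff.1 (hy j)).2
  rw [hij, h2] at h1
  have : n * j = n * i := by exact_mod_cast add_left_cancel h1
  exact (Nat.eq_of_mul_eq_mul_left (Nat.pos_of_ne_zero hn) this).symm

theorem meanOffspring_zero : 𝒢.meanOffspring 0 x p ≤ 1 := by
  have : (𝒢.finite_gen 0 x).toFinset = {x} := by ext; simp [gen_zero]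
  rw [meanOffspring, this, Finset.sum_singleton]
  exact measureReal_le_one

theorem exists_le_infiniteBelow (hm : ∀ x, 1 < 𝒢.meanOffspring n x p) :
    ∃ ε : ℝ, 0 < ε ∧ ε ≤ 1 ∧ ∀ x, ε ≤ (G.percolation p).real (𝒢.infiniteBelow x) := by
  obtain ⟨ε, h0, h1, hε⟩ := exists_le_survive hm
  refine ⟨ε, h0, h1, fun x => ?_⟩
  have hn : n ≠ 0 := by
    rintro rfl
    exact absurd (hm x) (not_lt.2 meanOffspring_zero)
  refine le_trans ?_ (measureReal_mono (iInter_survive_subset hn))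
  have hanti : Antitone fun k => 𝒢.survive n k x :=
    antitone_nat_of_succ_le fun k => survive_succ_subset
  have ht := tendsto_measure_iInter_atTop (μ := G.percolation p)
    (fun k => (measurableSet_survive (𝒢 := 𝒢) (n := n) (k := k) (x := x)).nullMeasurableSet)
    hanti ⟨0, measure_ne_top _ _⟩
  exact ge_of_tendsto' ((ENNReal.tendsto_toReal (measure_ne_top _ _)).comp ht) fun k => hε k x

/-- If the embedded branching process has more than one child on average, there is almost surely an
infinite cluster: the processes started from the siblings of the ancestors of a vertex are
independent and each of them survives with probability bounded below. -/
theorem measure_exists_infinite_eq_one [Nonempty V] (hm : ∀ x, 1 < 𝒢.meanOffspring n x p) :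
    G.percolation p {ω | ∃ o, (G.cluster ω o).Infinite} = 1 := by
  obtain ⟨ε, h0, h1, hε⟩ := exists_le_infiniteBelow hm
  obtain ⟨o⟩ := ‹Nonempty V›
  have hsib (i : ℕ) : ∃ y, y ≠ 𝒢.parent^[i] o ∧ 𝒢.parent y = 𝒢.parent^[i + 1] o := by
    obtain ⟨y, z, hyz, hy, hz⟩ := 𝒢.exists_children (𝒢.parent^[i + 1] o)
    by_cases h : y = 𝒢.parent^[i] o
    · exact ⟨z, fun h' => hyz (h.trans h'.symm), hz⟩
    · exact ⟨y, h, hy⟩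
  choose y hy hpar using hsib
  have hheight (i : ℕ) : 𝒢.height (y i) = 𝒢.height (𝒢.parent^[i] o) := by
    have := congrArg 𝒢.height (hpar i)
    rw [Function.iterate_succ_apply', 𝒢.height_parent, 𝒢.height_parent] at this
    omega
  have hlt {i j : ℕ} (hij : i < j) : Disjoint (𝒢.desc (y i)) (𝒢.desc (y j)) := by
    have h2 : y i ∈ 𝒢.desc (𝒢.parent^[j] o) := by
      refine ⟨j - i, ?_⟩
      obtain ⟨d, rfl⟩ : ∃ d, j = d + (i + 1) := ⟨j - (i + 1), by omega⟩
      rw [show d + (i + 1) - i = d + 1 by omega, Function.iterate_succ_apply, hpar,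
        ← Function.iterate_add_apply]
    exact (disjoint_desc (hheight j).symm (hy j).symm).mono_left (desc_subset h2)
  have hdisj : Pairwise fun i j => Disjoint (𝒢.inner (y i)) (𝒢.inner (y j)) := fun i j hij => by
    rcases hij.lt_or_gt with h | h
    · exact disjoint_inner (hlt h)
    · exact (disjoint_inner (hlt h)).symm
  have hk (k : ℕ) := real_forall_lt_le_pow (u := G.edgeSet) (p := p)
    (A := fun i => (𝒢.infiniteBelow (y i))ᶜ) (F := fun i => 𝒢.inner (y i))
    (fun i => measurableSet_infiniteBelow.compl) (fun i => determinedBy_infiniteBelow.compl)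
    hdisj (r := 1 - ε) (by linarith) (fun i => by
      have := hε (y i)
      rw [probReal_compl_eq_one_sub measurableSet_infiniteBelow]
      simp only [percolation] at this
      linarith) k
  have hz : (G.percolation p).real (⋃ i, 𝒢.infiniteBelow (y i))ᶜ ≤ 0 := by
    refine ge_of_tendsto' (tendsto_pow_atTop_nhds_zero_of_lt_one (r := 1 - ε) (by linarith)
      (by linarith)) fun k => le_trans (measureReal_mono ?_) (hk k)
    intro ω hω j _
    simp only [Set.mem_compl_iff, Set.mem_iUnion, not_exists] at hω
    exact hω j
  have hmeas : MeasurableSet (⋃ i, 𝒢.infiniteBelow (y i)) :=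
    MeasurableSet.iUnion fun i => measurableSet_infiniteBelow
  have hz' : G.percolation p (⋃ i, 𝒢.infiniteBelow (y i))ᶜ = 0 :=
    (measureReal_eq_zero_iff).1 (le_antisymm hz measureReal_nonneg)
  refine le_antisymm prob_le_one ?_
  rw [← (prob_compl_eq_zero_iff hmeas).1 hz']
  refine measure_mono (Set.iUnion_subset fun i ω hω => ⟨y i, Set.Infinite.mono (fun z hz => ?_) hω⟩)
  exact connEvent_mono inner_subset_edgeSet hz

/-- The children of `x` give a mean offspring of at least `2 * p` in the first generation. -/
theorem two_mul_le_meanOffspring_one (x : V) : 2 * (p : ℝ) ≤ 𝒢.meanOffspring 1 x p := by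
  classical
  obtain ⟨y, z, hyz, hy, hz⟩ := 𝒢.exists_children x
  have key {w : V} (hw : 𝒢.parent w = x) :
      (p : ℝ) ≤ (G.percolation p).real (connEvent (𝒢.upper 1 x) x w) := by
    have hadj : G.Adj w x := hw ▸ 𝒢.adj_parent w
    have h := real_subset (u := G.edgeSet) (p := p) {s(x, w)} (by simpa using hadj.symm)
    rw [Finset.card_singleton, pow_one] at h
    rw [← h]
    refine measureReal_mono fun ω hω =>
      mem_connEvent_of_mem (by simpa using hω) ⟨⟨hadj.symm, ?_⟩, ?_⟩
    · intro v hv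
      rcases Sym2.mem_iff.1 hv with rfl | rfl
      · exact self_mem_desc
      · exact ⟨1, hw⟩
    · exact ⟨x, by simp, by simp⟩
  calc 2 * (p : ℝ) ≤ ∑ w ∈ {y, z}, (G.percolation p).real (connEvent (𝒢.upper 1 x) x w) := by
        rw [Finset.sum_pair hyz]
        linarith [key hy, key hz]
    _ ≤ _ := by
        refine Finset.sum_le_sum_of_subset_of_nonneg ?_ fun _ _ _ => measureReal_nonneg
        intro w hw
        simp only [Finset.mem_insert, Finset.mem_singleton] at hw
        simp only [Set.Finite.mem_toFinset, gen, Function.iterate_one, Set.mem_ofPred_eq]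
        rcases hw with rfl | rfl <;> assumption

theorem continuous_meanOffspring (n : ℕ) (x : V) :
    Continuous fun p => 𝒢.meanOffspring n x p := by
  refine continuous_finsetSum _ fun y _ => ?_
  exact continuous_real_of_determinedBy (𝒢.finite_upper n x).toFinset
    (by simpa using determinedBy_connEvent)

end Genealogy

end SimpleGraph

/-! ### Cuts and exponential decay -/

namespace SimpleGraph

namespace Genealogy

variable {V : Type*} {G : SimpleGraph V} {𝒢 : Genealogy G} {x y z u v : V} {n k : ℕ}
  {p : unitInterval} {ω : Set (Sym2 V)}

/-- The edges of `G` between the descendants of `x` and the other vertices. -/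
def cut (𝒢 : Genealogy G) (x : V) : Set (Sym2 V) :=
  {e | e ∈ G.edgeSet ∧ (∃ u ∈ e, u ∈ 𝒢.desc x) ∧ ∃ v ∈ e, v ∉ 𝒢.desc x}

/-- The edges of `cut x` leave the descendants of `x` from one of the first `𝒢.range`
generations, since further down the common ancestor of the ends is still a descendant of `x`. -/
theorem height_lt_of_mem_cut {e : Sym2 V} (he : e ∈ 𝒢.cut x) (hu : u ∈ e)
    (hx : u ∈ 𝒢.desc x) : 𝒢.height u < 𝒢.height x + 𝒢.range := by
  obtain ⟨hadj, -, v, hv, hvx⟩ := he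
  have huv : u ≠ v := fun h => hvx (h ▸ hx)
  obtain rfl : e = s(u, v) := (Sym2.mem_and_mem_iff huv).1 ⟨hu, hv⟩
  obtain ⟨a, b, ha, hb, hab⟩ := exists_common_of_adj (𝒢 := 𝒢) hadj
  by_contra! h
  refine hvx (desc_subset (iterate_mem_desc (k := a) hx (by omega)) ?_)
  rw [hab]
  exact mem_desc_iterate b v

theorem finite_cut (𝒢 : Genealogy G) (x : V) : (𝒢.cut x).Finite := by
  refine ((Set.finite_lt_nat 𝒢.range).biUnion fun j _ => (𝒢.finite_gen j x).biUnion fun v _ =>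
    𝒢.finite_incident v).subset ?_
  intro e he
  obtain ⟨u, hu, hux⟩ := he.2.1
  have := height_lt_of_mem_cut he hu hux
  obtain ⟨k, hk⟩ := hux
  simp only [Set.mem_iUnion]
  refine ⟨k, ?_, u, hk, he.1, hu⟩
  rw [← hk, height_iterate] at this
  simp only [Set.mem_ofPred_eq]
  omega

theorem exists_card_cut_le (𝒢 : Genealogy G) : ∃ K, ∀ x, (𝒢.finite_cut x).toFinset.card ≤ K := by
  by_cases hV : Nonempty V
  · obtain ⟨o⟩ := hV
    refine ⟨(𝒢.finite_cut o).toFinset.card, fun x => ?_⟩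
    obtain ⟨g, hg, rfl⟩ := 𝒢.homogeneous x o
    refine Finset.card_le_card_of_injOn (Sym2.map g) (fun e he => ?_)
      (Sym2.map.injective g.injective).injOn
    simp only [Finset.mem_coe, Set.Finite.mem_toFinset] at he ⊢
    induction e with
    | _ a b =>
      have := g.map_adj_iff (v := a) (w := b)
      simpa [cut, map_mem_desc_iff hg, this] using he
  · exact ⟨0, fun x => (hV ⟨x⟩).elim⟩

theorem disjoint_cut {i j : ℕ} (h : i + 𝒢.range ≤ j) :
    Disjoint (𝒢.cut (𝒢.parent^[i] x)) (𝒢.cut (𝒢.parent^[j] x)) := by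
  refine Set.disjoint_left.2 fun e he he' => ?_
  obtain ⟨u, hu, hux⟩ := he.2.1
  have hij : 𝒢.parent^[i] x ∈ 𝒢.desc (𝒢.parent^[j] x) :=
    ⟨j - i, by rw [← Function.iterate_add_apply, Nat.sub_add_cancel (by omega)]⟩
  have h1 := height_lt_of_mem_cut he' hu (desc_subset hij hux)
  have h2 := height_le_of_mem_desc hux
  rw [height_iterate] at h1 h2
  omega

theorem not_disjoint_cut (h : ω ∈ connEvent G.edgeSet x y) (hx : x ∈ 𝒢.desc z)
    (hy : y ∉ 𝒢.desc z) : ¬ Disjoint ω (𝒢.cut z) := fun hd =>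
  hy <| connEvent_induction (P := (· ∈ 𝒢.desc z)) h hx fun u v hu hω hG _ => by
    by_contra hv
    exact Set.disjoint_left.1 hd hω ⟨hG, ⟨u, by simp, hu⟩, ⟨v, by simp, hv⟩⟩

theorem range_pos [Nonempty V] (𝒢 : Genealogy G) : 0 < 𝒢.range := by
  obtain ⟨x⟩ := ‹Nonempty V›
  have := height_le_add_range (𝒢 := 𝒢) (𝒢.adj_parent x).symm
  rw [𝒢.height_parent] at this
  omega

/-- It is exponentially unlikely that the cluster of `x` leaves the descendants of many ancestors
of `x`. -/
theorem exists_real_cut_le [Nonempty V] (𝒢 : Genealogy G) (hp : p < 1) :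
    ∃ r : ℝ, 0 < r ∧ r < 1 ∧ ∀ x k,
      (G.percolation p).real {ω | ∀ j < k, ¬ Disjoint ω (𝒢.cut (𝒢.parent^[𝒢.range * j] x))} ≤
        r ^ k := by
  have := 𝒢.countable
  obtain ⟨K, hK⟩ := 𝒢.exists_card_cut_le
  have hp1 : (p : ℝ) < 1 := hp
  have hp0 : (0 : ℝ) ≤ p := p.2.1
  -- The maximum keeps `r` positive for `p = 0`, so that it has a logarithm.
  refine ⟨max (1 - (1 - p : ℝ) ^ K) (1 / 2), by positivity,
    max_lt (sub_lt_self _ (pow_pos (by linarith) _)) (by norm_num), fun x k => ?_⟩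
  have hlt {i j : ℕ} (hij : i < j) : Disjoint (𝒢.cut (𝒢.parent^[𝒢.range * i] x))
      (𝒢.cut (𝒢.parent^[𝒢.range * j] x)) := disjoint_cut (by nlinarith)
  have h := real_forall_not_disjoint_le (u := G.edgeSet) (p := p)
    (fun j => (𝒢.finite_cut (𝒢.parent^[𝒢.range * j] x)).toFinset) (fun i j hij => by
      simp only [Set.Finite.coe_toFinset]
      rcases hij.lt_or_gt with h | h
      · exact hlt h
      · exact (hlt h).symm) K (fun j => hK _) k
  simp only [Set.Finite.coe_toFinset] at h
  exact h.trans (pow_le_pow_left₀ (sub_nonneg.2 (pow_le_one₀ (by linarith) (by linarith)))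
    (le_max_left _ _) k)

theorem exists_walk_iterate (k : ℕ) (x : V) : ∃ w : G.Walk x (𝒢.parent^[k] x), w.length = k := by
  induction k with
  | zero => exact ⟨.nil, rfl⟩
  | succ k ih =>
    obtain ⟨w, hw⟩ := ih
    have hadj : G.Adj (𝒢.parent^[k] x) (𝒢.parent^[k + 1] x) := by
      rw [Function.iterate_succ_apply']; exact 𝒢.adj_parent _
    exact ⟨w.concat hadj, by rw [Walk.length_concat, hw]⟩

theorem dist_le_add {a b : ℕ} (h : 𝒢.parent^[a] x = 𝒢.parent^[b] y) : G.dist x y ≤ a + b := by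
  obtain ⟨w, hw⟩ := exists_walk_iterate (𝒢 := 𝒢) a x
  obtain ⟨w', hw'⟩ := exists_walk_iterate (𝒢 := 𝒢) b y
  have := dist_le ((w.copy rfl h).append w'.reverse)
  simpa [hw, hw'] using this

/-- Below `p = 1`, connection probabilities decay exponentially: the path in the tree from one of
the two vertices up to their last common ancestor is crossed by a number of disjoint cuts that is
linear in the distance, and each of them contains an open edge. -/
theorem exists_real_connEvent_le_exp (𝒢 : Genealogy G) (hp : p < 1) : ∃ c : ℝ, 0 < c ∧ ∀ x y,
    (G.percolation p).real (connEvent G.edgeSet x y) ≤ Real.exp (-c * (G.dist x y : ℝ)) := by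
  by_cases hV : Nonempty V
  swap
  · exact ⟨1, one_pos, fun x => (hV ⟨x⟩).elim⟩
  obtain ⟨r, hr0, hr1, hr⟩ := 𝒢.exists_real_cut_le hp
  have hR := 𝒢.range_pos
  have hlog : Real.log r < 0 := Real.log_neg hr0 hr1
  have key {x y : V} {m : ℕ} (hm : ∀ i < m, y ∉ 𝒢.desc (𝒢.parent^[i] x))
      (hd : G.dist x y ≤ 2 * m) : (G.percolation p).real (connEvent G.edgeSet x y) ≤
        Real.exp (-(-Real.log r / (2 * 𝒢.range)) * (G.dist x y : ℝ)) := by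
    -- `k` is `m / 𝒢.range` rounded up: the number of multiples of `𝒢.range` below `m`.
    set k := (m + 𝒢.range - 1) / 𝒢.range
    have hk1 (j : ℕ) (hj : j < k) : 𝒢.range * j < m := by
      have h1 := Nat.div_mul_le_self (m + 𝒢.range - 1) 𝒢.range
      have h2 : (j + 1) * 𝒢.range ≤ k * 𝒢.range := Nat.mul_le_mul_right _ hj
      change k * 𝒢.range ≤ _ at h1
      rw [add_mul, one_mul, mul_comm j] at h2
      omega
    have hk2 : m ≤ k * 𝒢.range := by
      have h1 := Nat.lt_div_mul_add (a := m + 𝒢.range - 1) hR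
      change _ < k * 𝒢.range + 𝒢.range at h1
      omega
    have hk3 : (G.dist x y : ℝ) / (2 * 𝒢.range) ≤ k := by
      rw [div_le_iff₀ (by positivity)]
      have : G.dist x y ≤ k * (2 * 𝒢.range) := by nlinarith
      exact_mod_cast this
    calc _ ≤ r ^ k := (measureReal_mono (fun ω hω j hj => not_disjoint_cut hω
            (mem_desc_iterate _ _) (hm _ (hk1 j hj))) (measure_ne_top _ _)).trans (hr x k)
      _ = Real.exp (Real.log r * k) := by
          rw [← Real.rpow_natCast, Real.rpow_def_of_pos hr0]
      _ ≤ Real.exp (Real.log r * ((G.dist x y : ℝ) / (2 * 𝒢.range))) :=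
          Real.exp_le_exp.2 (mul_le_mul_of_nonpos_left hk3 hlog.le)
      _ = _ := by congr 1; ring
  refine ⟨-Real.log r / (2 * 𝒢.range), div_pos (by linarith) (by positivity), fun x y => ?_⟩
  classical
  have hex := 𝒢.exists_common x y
  obtain ⟨b, hb⟩ := Nat.find_spec hex
  set a := Nat.find hex
  have ha (i : ℕ) (hi : i < a) : y ∉ 𝒢.desc (𝒢.parent^[i] x) := fun ⟨j, hj⟩ =>
    Nat.find_min hex hi ⟨j, hj.symm⟩
  have hd := dist_le_add hb
  rcases le_total b a with h | h
  · exact key ha (by omega)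
  · have hsymm : connEvent G.edgeSet x y = connEvent G.edgeSet y x :=
      Set.ext fun ω => ⟨connEvent_symm, connEvent_symm⟩
    rw [hsymm, dist_comm]
    refine key (m := b) (fun i hi ⟨j, hj⟩ => ?_) (by rw [dist_comm]; omega)
    have h1 := congrArg 𝒢.height hj
    have h2 := congrArg 𝒢.height hb
    simp only [height_iterate] at h1 h2
    exact Nat.find_min hex (m := j) (by omega) ⟨i, hj⟩

/-- The edges of the tree between `x` and its `k`-th ancestor. -/
noncomputable def ancestorEdges (𝒢 : Genealogy G) (k : ℕ) (x : V) : Finset (Sym2 V) :=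
  letI := Classical.decEq (Sym2 V)
  (Finset.range k).image fun i => s(𝒢.parent^[i] x, 𝒢.parent^[i + 1] x)

theorem card_ancestorEdges_le : (𝒢.ancestorEdges k x).card ≤ k :=
  letI := Classical.decEq (Sym2 V)
  Finset.card_image_le.trans (by simp)

theorem ancestorEdges_subset_upper (hx : x ∈ 𝒢.gen (n + k) z) :
    (𝒢.ancestorEdges k x : Set (Sym2 V)) ⊆ 𝒢.upper (n + k) z := by
  intro e he
  simp only [ancestorEdges, Finset.coe_image, Finset.coe_range, Set.mem_image, Set.mem_Iio] at he
  obtain ⟨i, hi, rfl⟩ := he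
  obtain ⟨hx1, hx2⟩ := mem_gen_iff.1 hx
  refine ⟨⟨?_, ?_⟩, 𝒢.parent^[i + 1] x, by simp, ?_⟩
  · rw [Function.iterate_succ_apply', mem_edgeSet]
    exact 𝒢.adj_parent _
  · intro v hv
    rcases Sym2.mem_iff.1 hv with rfl | rfl <;> exact iterate_mem_desc hx1 (by omega)
  · rw [height_iterate]; omega

theorem mem_connEvent_iterate {F : Set (Sym2 V)} (hω : (𝒢.ancestorEdges k x : Set (Sym2 V)) ⊆ ω)
    (hF : (𝒢.ancestorEdges k x : Set (Sym2 V)) ⊆ F) : ω ∈ connEvent F x (𝒢.parent^[k] x) := by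
  have h (i : ℕ) (hi : i ≤ k) : ω ∈ connEvent F x (𝒢.parent^[i] x) := by
    induction i with
    | zero => exact connEvent_refl
    | succ i ih =>
      have hmem : s(𝒢.parent^[i] x, 𝒢.parent^[i + 1] x) ∈ (𝒢.ancestorEdges k x : Set (Sym2 V)) := by
        simp only [ancestorEdges, Finset.coe_image, Finset.coe_range]
        exact ⟨i, hi, rfl⟩
      exact connEvent_trans (ih (by omega)) (mem_connEvent_of_mem (hω hmem) (hF hmem))
  exact h k le_rfl

/-- A set of edges that contains all edges of `G` within the cluster of `x` suffices to connect the
cluster. -/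
theorem connEvent_of_cluster_edges_mem {F : Set (Sym2 V)} (h : ω ∈ connEvent G.edgeSet x y)
    (hF : ∀ u v, ω ∈ connEvent G.edgeSet x u → ω ∈ connEvent G.edgeSet x v → G.Adj u v →
      s(u, v) ∈ F) : ω ∈ connEvent F x y := by
  refine (connEvent_induction (P := fun v => ω ∈ connEvent G.edgeSet x v ∧ ω ∈ connEvent F x v) h
    ⟨connEvent_refl, connEvent_refl⟩ fun u v hu huv hG _ => ?_).2
  have hv := connEvent_trans hu.1 (mem_connEvent_of_mem huv hG)
  exact ⟨hv, connEvent_trans hu.2 (mem_connEvent_of_mem huv (hF u v hu.1 hv hG))⟩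

/-- If infinite clusters occur, then with positive probability some vertex has an infinite cluster
inside the set of its descendants: the cluster of a vertex almost surely stays below one of its
ancestors, and the path to this ancestor can be opened. -/
theorem exists_infiniteBelow_pos (𝒢 : Genealogy G) (hp0 : 0 < p) (hp : p < 1)
    (h : G.percolation p {ω | ∃ o, (G.cluster ω o).Infinite} ≠ 0) :
    ∃ x, 0 < (G.percolation p).real (𝒢.infiniteBelow x) := by
  have := 𝒢.countable
  obtain ⟨o, ho⟩ : ∃ o, G.percolation p {ω | (G.cluster ω o).Infinite} ≠ 0 := by
    by_contra! h'
    refine h ?_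
    rw [Set.ofPred_exists]
    exact measure_iUnion_null h'
  have : Nonempty V := ⟨o⟩
  obtain ⟨r, hr0, hr1, hr⟩ := 𝒢.exists_real_cut_le hp
  have hleave : G.percolation p
      {ω | ∀ k, ∃ y, ω ∈ connEvent G.edgeSet o y ∧ y ∉ 𝒢.desc (𝒢.parent^[k] o)} = 0 := by
    refine (measureReal_eq_zero_iff (measure_ne_top _ _)).1 (le_antisymm ?_ measureReal_nonneg)
    refine ge_of_tendsto' (tendsto_pow_atTop_nhds_zero_of_lt_one hr0.le hr1) fun k =>
      le_trans (measureReal_mono ?_ (measure_ne_top _ _)) (hr o k)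
    intro ω hω j hj
    obtain ⟨y, hy, hy'⟩ := hω (𝒢.range * j)
    exact not_disjoint_cut hy (mem_desc_iterate _ _) hy'
  obtain ⟨k, hk⟩ : ∃ k, G.percolation p
      {ω | {y | ω ∈ connEvent (𝒢.inner (𝒢.parent^[k] o)) o y}.Infinite} ≠ 0 := by
    by_contra! h'
    refine ho (measure_mono_null (t := _ ∪ ⋃ k, _) ?_ (measure_union_null hleave
      (measure_iUnion_null h')))
    intro ω hω
    by_cases hl : ∀ k, ∃ y, ω ∈ connEvent G.edgeSet o y ∧ y ∉ 𝒢.desc (𝒢.parent^[k] o)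
    · exact Or.inl hl
    · push Not at hl
      obtain ⟨k, hk⟩ := hl
      refine Or.inr (Set.mem_iUnion.2 ⟨k, Set.Infinite.mono (fun y hy => ?_) hω⟩)
      refine connEvent_of_cluster_edges_mem hy fun u v hu hv huv => ⟨huv, fun w hw => ?_⟩
      rcases Sym2.mem_iff.1 hw with rfl | rfl
      · exact hk _ hu
      · exact hk _ hv
  refine ⟨𝒢.parent^[k] o, ?_⟩
  have hF : (𝒢.ancestorEdges k o : Set (Sym2 V)) ⊆ 𝒢.inner (𝒢.parent^[k] o) :=
    (ancestorEdges_subset_upper (n := 0) (by simp [gen])).trans upper_subset_inner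
  have hins := real_mul_pow_le_of_monotone (u := G.edgeSet) (p := p)
    (A := {ω | {y | ω ∈ connEvent (𝒢.inner (𝒢.parent^[k] o)) o y}.Infinite})
    measurableSet_infinite_connEvent (fun ω ω' hωω' hω => Set.Infinite.mono (fun y hy =>
      mem_connEvent_of_subset (Set.inter_subset_inter_left _ hωω') hy) hω) (𝒢.ancestorEdges k o)
    (hF.trans inner_subset_edgeSet)
  have hpos : 0 < (G.percolation p).real
      {ω | {y | ω ∈ connEvent (𝒢.inner (𝒢.parent^[k] o)) o y}.Infinite} :=
    lt_of_le_of_ne measureReal_nonneg fun h0 =>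
      hk ((measureReal_eq_zero_iff (measure_ne_top _ _)).1 h0.symm)
  have hp0' : (0 : ℝ) < p := hp0
  refine lt_of_lt_of_le (mul_pos hpos (pow_pos hp0' _)) (hins.trans
    (measureReal_mono (fun ω hω => ?_) (measure_ne_top _ _)))
  exact Set.Infinite.mono (fun y hy => connEvent_trans
    (connEvent_symm (mem_connEvent_iterate hω.2 hF)) hy) hω.1

end Genealogy

end SimpleGraph

/-! ### Growth of infinite clusters -/

namespace SimpleGraph

/-- Markov's inequality for the number of events that occur. -/
theorem mul_real_le_sum_real {Ω κ : Type*} [MeasurableSpace Ω] {μ : Measure Ω}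
    [IsProbabilityMeasure μ] {A : κ → Set Ω} (hA : ∀ i, MeasurableSet (A i)) (s : Finset κ)
    {B : Set Ω} {K : ℕ} (hB : ∀ ω ∈ B, ∃ t ⊆ s, K ≤ t.card ∧ ∀ i ∈ t, ω ∈ A i) :
    K * μ.real B ≤ ∑ i ∈ s, μ.real (A i) := by
  have hint (i : κ) : Integrable ((A i).indicator (1 : Ω → ℝ)) μ :=
    (integrable_const (1 : ℝ)).indicator (hA i)
  have h := mul_meas_ge_le_integral_of_nonneg (μ := μ)
    (f := fun ω => ∑ i ∈ s, (A i).indicator (1 : Ω → ℝ) ω)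
    (.of_forall fun ω => Finset.sum_nonneg fun i _ => Set.indicator_nonneg (by simp) _)
    (integrable_finsetSum _ fun i _ => hint i) K
  rw [integral_finsetSum _ fun i _ => hint i] at h
  simp only [integral_indicator_one (hA _)] at h
  refine le_trans ?_ h
  refine mul_le_mul_of_nonneg_left (measureReal_mono ?_ (measure_ne_top _ _)) (Nat.cast_nonneg K)
  intro ω hω
  obtain ⟨t, hts, hK, ht⟩ := hB ω hω
  calc (K : ℝ) ≤ t.card := by exact_mod_cast hK
    _ = ∑ i ∈ t, (A i).indicator (1 : Ω → ℝ) ω := by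
        rw [Finset.sum_congr rfl fun i hi => Set.indicator_of_mem (ht i hi) _]; simp
    _ ≤ _ := Finset.sum_le_sum_of_subset_of_nonneg hts fun i _ _ =>
        Set.indicator_nonneg (by simp) _

namespace Genealogy

variable {V : Type*} {G : SimpleGraph V} {𝒢 : Genealogy G} {x y z u v w : V} {n k : ℕ}
  {p : unitInterval} {ω : Set (Sym2 V)}

/-- The vertices of generation at least `n` that are joined to `x` through `𝒢.upper n x`. -/
def front (𝒢 : Genealogy G) (n : ℕ) (x : V) (ω : Set (Sym2 V)) : Set V :=
  {w | ω ∈ connEvent (𝒢.upper n x) x w ∧ 𝒢.height x + n ≤ 𝒢.height w}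

/-- The members of the generations `n, …, n + 𝒢.range - 1` of `x`. -/
def band (𝒢 : Genealogy G) (n : ℕ) (x : V) : Set V := ⋃ j < 𝒢.range, 𝒢.gen (n + j) x

theorem finite_band (𝒢 : Genealogy G) (n : ℕ) (x : V) : (𝒢.band n x).Finite :=
  (Set.finite_lt_nat 𝒢.range).biUnion fun _ _ => 𝒢.finite_gen _ _

theorem front_subset_band (hn : n ≠ 0) : 𝒢.front n x ω ⊆ 𝒢.band n x := by
  rintro w ⟨hw, hle⟩
  have h := connEvent_induction
    (P := fun v => v ∈ 𝒢.desc x ∧ 𝒢.height v < 𝒢.height x + n + 𝒢.range) hw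
    ⟨self_mem_desc, by omega⟩ fun u v _ _ hF _ => by
      refine ⟨hF.1.2 v (by simp), ?_⟩
      obtain ⟨a, ha, hlt⟩ := hF.2
      rcases Sym2.mem_iff.1 ha with rfl | rfl
      · have := height_le_add_range (𝒢 := 𝒢) (show G.Adj a v from hF.1.1)
        omega
      · omega
  simp only [band, Set.mem_iUnion]
  refine ⟨(𝒢.height w - 𝒢.height x - n).toNat, by omega, mem_gen_iff.2 ⟨h.1, ?_⟩⟩
  push_cast
  omega

/-- If no open edge leads further down from the front, the cluster of `x` inside its descendants
has been explored completely. -/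
theorem connEvent_upper_of_closed (hω : ω ∈ connEvent (𝒢.inner x) x y)
    (h : ∀ u ∈ 𝒢.front n x ω, ∀ v, s(u, v) ∈ ω → s(u, v) ∈ G.edgeSet → s(u, v) ∈ 𝒢.upper n x) :
    ω ∈ connEvent (𝒢.upper n x) x y :=
  connEvent_induction (P := fun v => ω ∈ connEvent (𝒢.upper n x) x v) hω connEvent_refl
    fun u v hu huv hF _ => by
      refine connEvent_trans hu (mem_connEvent_of_mem huv ?_)
      by_cases hlt : 𝒢.height u < 𝒢.height x + n
      · exact ⟨hF, u, by simp, hlt⟩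
      · exact h u ⟨hu, not_lt.1 hlt⟩ v huv hF.1

theorem front_nonempty_of_le {m : ℕ} (hmn : n ≤ m) (h : (𝒢.front m x ω).Nonempty) :
    (𝒢.front n x ω).Nonempty := by
  by_contra hne
  rw [Set.not_nonempty_iff_eq_empty] at hne
  obtain ⟨w, hw, hle⟩ := h
  have := connEvent_upper_of_closed (n := n) (connEvent_mono upper_subset_inner hw)
    (by simp [hne])
  have hmem : w ∈ 𝒢.front n x ω := ⟨this, by omega⟩
  simp [hne] at hmem

theorem front_nonempty_of_infinite (h : ω ∈ 𝒢.infiniteBelow x) (n : ℕ) :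
    (𝒢.front n x ω).Nonempty := by
  by_contra hne
  rw [Set.not_nonempty_iff_eq_empty] at hne
  refine h (((Set.finite_lt_nat n).biUnion fun j _ => 𝒢.finite_gen j x).subset fun y hy => ?_)
  have hy' := connEvent_upper_of_closed (n := n) hy (by simp [hne])
  have hlt : 𝒢.height y < 𝒢.height x + n := by
    by_contra hle
    have hmem : y ∈ 𝒢.front n x ω := ⟨hy', not_lt.1 hle⟩
    simp [hne] at hmem
  have hdesc : y ∈ 𝒢.desc x := connEvent_induction (P := (· ∈ 𝒢.desc x)) hy self_mem_desc
    fun u v _ _ hF _ => hF.2 v (by simp)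
  have := height_le_of_mem_desc hdesc
  simp only [Set.mem_iUnion]
  exact ⟨(𝒢.height y - 𝒢.height x).toNat, by simp only [Set.mem_ofPred_eq]; omega,
    mem_gen_iff.2 ⟨hdesc, by omega⟩⟩

/-- The edges of `G` incident to a vertex of `W` that do not belong to `𝒢.upper n x`. -/
noncomputable def lowerEdges (𝒢 : Genealogy G) (n : ℕ) (x : V) (W : Finset V) : Finset (Sym2 V) :=
  letI := Classical.decEq (Sym2 V)
  (W.biUnion fun w => (𝒢.finite_incident w).toFinset) \ (𝒢.finite_upper n x).toFinset

theorem mem_lowerEdges {W : Finset V} {e : Sym2 V} :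
    e ∈ 𝒢.lowerEdges n x W ↔ (∃ w ∈ W, e ∈ G.edgeSet ∧ w ∈ e) ∧ e ∉ 𝒢.upper n x := by
  simp [lowerEdges]

theorem exists_card_incident_le (𝒢 : Genealogy G) :
    ∃ Δ, ∀ x, (𝒢.finite_incident x).toFinset.card ≤ Δ := by
  by_cases hV : Nonempty V
  · obtain ⟨o⟩ := hV
    refine ⟨(𝒢.finite_incident o).toFinset.card, fun x => ?_⟩
    obtain ⟨g, hg, rfl⟩ := 𝒢.homogeneous x o
    refine Finset.card_le_card_of_injOn (Sym2.map g) (fun e he => ?_)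
      (Sym2.map.injective g.injective).injOn
    simp only [Finset.mem_coe, Set.Finite.mem_toFinset] at he ⊢
    induction e with
    | _ a b =>
      have := g.map_adj_iff (v := a) (w := b)
      simpa [this] using he
  · exact ⟨0, fun x => (hV ⟨x⟩).elim⟩

theorem card_lowerEdges_le {Δ : ℕ} (hΔ : ∀ x, (𝒢.finite_incident x).toFinset.card ≤ Δ)
    (W : Finset V) : (𝒢.lowerEdges n x W).card ≤ W.card * Δ :=
  letI := Classical.decEq (Sym2 V)
  (Finset.card_le_card Finset.sdiff_subset).trans
    (Finset.card_biUnion_le_card_mul _ _ _ fun w _ => hΔ w)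

/-- Once the edges leading down from the front in generation `n` are closed, no vertex of generation
`n + 𝒢.range` or later is reached, because one step descends by at most `𝒢.range` generations. -/
theorem not_nonempty_front_add_range {W : Finset V} (hn : n ≠ 0) (hW : 𝒢.front n x ω = W)
    (hd : Disjoint ω (𝒢.lowerEdges n x W : Set (Sym2 V))) :
    ¬ (𝒢.front (n + 𝒢.range) x ω).Nonempty := by
  rintro ⟨w, hw, hle⟩
  have h := connEvent_upper_of_closed (n := n) (connEvent_mono upper_subset_inner hw)
    fun u hu v huv hG => by
      by_contra hup
      refine Set.disjoint_left.1 hd huv (mem_lowerEdges.2 ⟨⟨u, ?_, hG, by simp⟩, hup⟩)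
      rw [hW] at hu
      exact hu
  have hmem : w ∈ 𝒢.band n x := front_subset_band hn ⟨h, by omega⟩
  simp only [band, Set.mem_iUnion] at hmem
  obtain ⟨j, hj, hj'⟩ := hmem
  have := (mem_gen_iff.1 hj').2
  push_cast at this hle
  omega

theorem measurable_front : Measurable (𝒢.front n x) := by
  have := 𝒢.countable
  rw [measurable_set_iff]
  exact fun w => measurable_mem.2 (measurableSet_connEvent.inter (MeasurableSet.const _))

theorem determinedBy_front (S : Set (Set V)) : DeterminedBy {ω | 𝒢.front n x ω ∈ S} (𝒢.upper n x) :=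
  .of_inter_iff fun ω => by
    simp only [front, Set.mem_ofPred_eq, determinedBy_connEvent.inter_mem_iff]

theorem measurableSet_front_nonempty : MeasurableSet {ω | (𝒢.front n x ω).Nonempty} := by
  have := 𝒢.countable
  have h := (measurable_front (𝒢 := 𝒢) (n := n) (x := x)) (measurableSet_singleton ∅).compl
  convert h using 1
  ext ω
  simp [Set.nonempty_iff_ne_empty]

/-- If the front in generation `n` has between one and `K` vertices, then with probability bounded
below the cluster dies out within the next `𝒢.range` generations. -/
theorem pow_mul_real_front_le {Δ : ℕ} (hΔ : ∀ x, (𝒢.finite_incident x).toFinset.card ≤ Δ)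
    (hn : n ≠ 0) (K : ℕ) :
    (G.percolation p).real
        {ω | (𝒢.front n x ω).Nonempty ∧ ¬ K < (𝒢.front n x ω).ncard} * (1 - p : ℝ) ^ (K * Δ) ≤
      (G.percolation p).real {ω | (𝒢.front n x ω).Nonempty} -
        (G.percolation p).real {ω | (𝒢.front (n + 𝒢.range) x ω).Nonempty} := by
  classical
  have := 𝒢.countable
  have hp0 : (0 : ℝ) ≤ 1 - p := by linarith [p.2.2]
  have hp1 : (1 - p : ℝ) ≤ 1 := by linarith [p.2.1]
  set S := (𝒢.finite_band n x).toFinset.powerset.filter fun W : Finset V => W.Nonempty ∧ W.card ≤ K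
  have hmeas (W : Finset V) : MeasurableSet {ω | 𝒢.front n x ω = W} :=
    measurable_front (measurableSet_singleton (W : Set V))
  have hdet (W : Finset V) : DeterminedBy {ω | 𝒢.front n x ω = W} (𝒢.upper n x) :=
    determinedBy_front {(W : Set V)}
  have h1 : (G.percolation p).real
      {ω | (𝒢.front n x ω).Nonempty ∧ ¬ K < (𝒢.front n x ω).ncard} ≤
      ∑ W ∈ S, (G.percolation p).real {ω | 𝒢.front n x ω = W} := by
    refine (measureReal_mono ?_ (measure_ne_top _ _)).trans (measureReal_biUnion_finset_le _ _)
    rintro ω ⟨hne, hK⟩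
    have hfin := (𝒢.finite_band n x).subset (front_subset_band (ω := ω) hn)
    simp only [Set.mem_iUnion]
    refine ⟨hfin.toFinset, ?_, by simp⟩
    rw [Set.ncard_eq_toFinset_card _ hfin] at hK
    simp only [S, Finset.mem_filter, Finset.mem_powerset]
    exact ⟨by simpa using front_subset_band hn, by simpa using hne, not_lt.1 hK⟩
  calc _ ≤ (∑ W ∈ S, (G.percolation p).real {ω | 𝒢.front n x ω = W}) * (1 - p : ℝ) ^ (K * Δ) := by
        gcongr
    _ ≤ ∑ W ∈ S, (G.percolation p).real ({ω | 𝒢.front n x ω = W} ∩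
          {ω | Disjoint ω (𝒢.lowerEdges n x W : Set (Sym2 V))}) := by
        rw [Finset.sum_mul]
        refine Finset.sum_le_sum fun W hW => ?_
        simp only [S, Finset.mem_filter] at hW
        rw [percolation, real_inter_of_determinedBy (hmeas W) (measurableSet_disjoint _) (hdet W)
          determinedBy_disjoint]
        · gcongr
          refine le_trans (pow_le_pow_of_le_one hp0 hp1 ?_) (pow_card_le_real_disjoint _)
          exact (card_lowerEdges_le hΔ W).trans (Nat.mul_le_mul_right _ hW.2.2)
        · exact Set.disjoint_left.2 fun e he he' => (mem_lowerEdges.1 he').2 he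
    _ = (G.percolation p).real (⋃ W ∈ S, {ω | 𝒢.front n x ω = W} ∩
          {ω | Disjoint ω (𝒢.lowerEdges n x W : Set (Sym2 V))}) := by
        rw [measureReal_biUnion_finset]
        · intro W _ W' _ hne
          refine Set.disjoint_left.2 fun ω h h' => hne ?_
          exact Finset.coe_injective (h.1.symm.trans h'.1)
        · exact fun W _ => (hmeas W).inter (measurableSet_disjoint _)
    _ ≤ (G.percolation p).real ({ω | (𝒢.front n x ω).Nonempty} \
          {ω | (𝒢.front (n + 𝒢.range) x ω).Nonempty}) := by
        refine measureReal_mono (Set.iUnion₂_subset fun W hW ω hω => ⟨?_, ?_⟩) (measure_ne_top _ _)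
        · simp only [S, Finset.mem_filter] at hW
          have : 𝒢.front n x ω = W := hω.1
          simp only [Set.mem_ofPred_eq, this]
          exact hW.2.1
        · exact not_nonempty_front_add_range hn hω.1 hω.2
    _ = _ := measureReal_sdiff (fun ω hω => front_nonempty_of_le (Nat.le_add_right _ _) hω)
        measurableSet_front_nonempty

/-- A connection from `x` to generation `n` can be prolonged along a path of the tree. -/
theorem real_connEvent_mul_pow_le (hy : y ∈ 𝒢.gen (n + k) x) :
    (G.percolation p).real (connEvent (𝒢.upper n x) x (𝒢.parent^[k] y)) * (p : ℝ) ^ k ≤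
      (G.percolation p).real (connEvent (𝒢.upper (n + k) x) x y) := by
  have := 𝒢.countable
  have hF := ancestorEdges_subset_upper (𝒢 := 𝒢) hy
  have hins := real_mul_pow_le_of_monotone (u := G.edgeSet) (p := p)
    (A := connEvent (𝒢.upper n x) x (𝒢.parent^[k] y))
    measurableSet_connEvent (fun ω ω' hωω' hω =>
      mem_connEvent_of_subset (Set.inter_subset_inter_left _ hωω') hω) (𝒢.ancestorEdges k y)
    (hF.trans (upper_subset_inner.trans inner_subset_edgeSet))
  refine le_trans ?_ (hins.trans (measureReal_mono (fun ω hω => ?_) (measure_ne_top _ _)))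
  · exact mul_le_mul_of_nonneg_left (pow_le_pow_of_le_one p.2.1 p.2.2 card_ancestorEdges_le)
      measureReal_nonneg
  · exact connEvent_trans (connEvent_mono (upper_mono (Nat.le_add_right _ _)) hω.1)
      (connEvent_symm (mem_connEvent_iterate hω.2 hF))

/-- Prolonging the connections to one generation by fixed lines of descent, which are distinct for
distinct vertices, gives connections to a later generation. -/
theorem sum_gen_mul_pow_le (n k : ℕ) (x : V) (m : ℕ) :
    (∑ w ∈ (𝒢.finite_gen (n + m) x).toFinset,
        (G.percolation p).real (connEvent (𝒢.upper n x) x w)) * (p : ℝ) ^ k ≤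
      𝒢.meanOffspring (n + m + k) x p := by
  classical
  choose c _ _ hc _ using 𝒢.exists_children
  have hck (k : ℕ) (w : V) : 𝒢.parent^[k] (c^[k] w) = w :=
    (show Function.LeftInverse 𝒢.parent c from hc).iterate k w
  have hinj : Function.Injective c^[k] := fun a b h => by rw [← hck k a, h, hck]
  rw [Finset.sum_mul]
  calc _ ≤ ∑ w ∈ (𝒢.finite_gen (n + m) x).toFinset,
        (G.percolation p).real (connEvent (𝒢.upper (n + m + k) x) x (c^[k] w)) := by
        refine Finset.sum_le_sum fun w hw => ?_
        simp only [Set.Finite.mem_toFinset] at hw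
        have hw' : c^[k] w ∈ 𝒢.gen (n + m + k) x := by
          change 𝒢.parent^[n + m + k] (c^[k] w) = x
          rw [Function.iterate_add_apply, hck]
          exact hw
        refine le_trans ?_ (real_connEvent_mul_pow_le hw')
        rw [hck]
        refine mul_le_mul_of_nonneg_right (measureReal_mono (connEvent_mono
          (upper_mono (Nat.le_add_right _ _))) (measure_ne_top _ _)) (pow_nonneg p.2.1 _)
    _ = ∑ y ∈ (𝒢.finite_gen (n + m) x).toFinset.image c^[k],
        (G.percolation p).real (connEvent (𝒢.upper (n + m + k) x) x y) :=
        (Finset.sum_image (f := fun y => (G.percolation p).real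
          (connEvent (𝒢.upper (n + m + k) x) x y)) hinj.injOn).symm
    _ ≤ _ := by
        refine Finset.sum_le_sum_of_subset_of_nonneg ?_ fun _ _ _ => measureReal_nonneg
        intro y hy
        simp only [Finset.mem_image, Set.Finite.mem_toFinset] at hy ⊢
        obtain ⟨w, hw, rfl⟩ := hy
        change 𝒢.parent^[n + m + k] (c^[k] w) = x
        rw [Function.iterate_add_apply, hck]
        exact hw

theorem sum_band_mul_pow_le (n : ℕ) (x : V) :
    (∑ w ∈ (𝒢.finite_band n x).toFinset,
        (G.percolation p).real (connEvent (𝒢.upper n x) x w)) * (p : ℝ) ^ 𝒢.range ≤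
      𝒢.range * 𝒢.meanOffspring (n + 𝒢.range) x p := by
  classical
  have hp0 : (0 : ℝ) ≤ p := p.2.1
  have hsub : (𝒢.finite_band n x).toFinset ⊆
      (Finset.range 𝒢.range).biUnion fun j => (𝒢.finite_gen (n + j) x).toFinset := by
    intro w hw
    simpa [band] using hw
  have hdisj : Set.PairwiseDisjoint (Finset.range 𝒢.range : Set ℕ)
      fun j => (𝒢.finite_gen (n + j) x).toFinset := by
    intro i _ j _ hij
    refine Finset.disjoint_left.2 fun w hw hw' => hij ?_
    simp only [Set.Finite.mem_toFinset] at hw hw'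
    have h1 := (mem_gen_iff.1 hw).2
    have h2 := (mem_gen_iff.1 hw').2
    push_cast at h1 h2
    omega
  calc _ ≤ (∑ j ∈ Finset.range 𝒢.range, ∑ w ∈ (𝒢.finite_gen (n + j) x).toFinset,
        (G.percolation p).real (connEvent (𝒢.upper n x) x w)) * (p : ℝ) ^ 𝒢.range := by
        gcongr
        exact (Finset.sum_le_sum_of_subset_of_nonneg hsub fun _ _ _ => measureReal_nonneg).trans
          (Finset.sum_biUnion hdisj).le
    _ ≤ ∑ _j ∈ Finset.range 𝒢.range, 𝒢.meanOffspring (n + 𝒢.range) x p := by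
        rw [Finset.sum_mul]
        refine Finset.sum_le_sum fun j hj => ?_
        have hj := Finset.mem_range.1 hj
        have h := sum_gen_mul_pow_le (𝒢 := 𝒢) (p := p) n (𝒢.range - j) x j
        rw [show n + j + (𝒢.range - j) = n + 𝒢.range by omega] at h
        refine le_trans (mul_le_mul_of_nonneg_left (pow_le_pow_of_le_one hp0 p.2.2
          (Nat.sub_le _ _)) (Finset.sum_nonneg fun _ _ => measureReal_nonneg)) h
    _ = _ := by simp

/-- If infinite clusters below a vertex have positive probability, some generation of the embedded
branching process has mean offspring above one: the probability that the front is nonempty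
converges, so a nonempty front is unlikely to be small, and its expected size tends to infinity. -/
theorem exists_one_lt_meanOffspring (hp0 : 0 < p) (hp : p < 1)
    (hx : 0 < (G.percolation p).real (𝒢.infiniteBelow x)) :
    ∃ n, 1 < 𝒢.meanOffspring n x p := by
  have := 𝒢.countable
  have : Nonempty V := ⟨x⟩
  have hp0' : (0 : ℝ) < p := hp0
  have hp' : (0 : ℝ) < 1 - p := sub_pos.2 hp
  obtain ⟨Δ, hΔ⟩ := 𝒢.exists_card_incident_le
  have hR := 𝒢.range_pos
  set ψ := (G.percolation p).real (𝒢.infiniteBelow x)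
  set a : ℕ → ℝ := fun n => (G.percolation p).real {ω | (𝒢.front n x ω).Nonempty}
  have ha (n : ℕ) : ψ ≤ a n :=
    measureReal_mono (fun ω hω => front_nonempty_of_infinite hω n) (measure_ne_top _ _)
  have hanti : Antitone a := fun m n hmn =>
    measureReal_mono (fun ω hω => front_nonempty_of_le hmn hω) (measure_ne_top _ _)
  have hlim : Filter.Tendsto (fun n => a n - a (n + 𝒢.range)) Filter.atTop (nhds 0) := by
    have h1 := tendsto_atTop_ciInf hanti ⟨0, by rintro _ ⟨n, rfl⟩; exact measureReal_nonneg⟩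
    simpa using h1.sub (h1.comp (Filter.tendsto_add_atTop_nat 𝒢.range))
  -- `K` is large enough that a front of more than `K` vertices with probability at least `ψ / 2`
  -- forces mean offspring above one in generation `n + 𝒢.range`.
  obtain ⟨K, hK⟩ := exists_nat_gt (𝒢.range / (p : ℝ) ^ 𝒢.range / (ψ / 2))
  have hε : 0 < ψ / 2 * (1 - p : ℝ) ^ (K * Δ) := by positivity
  obtain ⟨n, hn0, hn⟩ := ((Filter.eventually_ne_atTop 0).and (hlim.eventually_lt_const hε)).exists
  refine ⟨n + 𝒢.range, ?_⟩
  have hsmall : (G.percolation p).real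
      {ω | (𝒢.front n x ω).Nonempty ∧ ¬ K < (𝒢.front n x ω).ncard} < ψ / 2 :=
    lt_of_mul_lt_mul_right ((pow_mul_real_front_le hΔ hn0 K).trans_lt hn) (by positivity)
  have hlarge : ψ / 2 ≤ (G.percolation p).real {ω | K < (𝒢.front n x ω).ncard} := by
    have : a n ≤ _ := (measureReal_mono (s₂ := {ω | K < (𝒢.front n x ω).ncard} ∪
      {ω | (𝒢.front n x ω).Nonempty ∧ ¬ K < (𝒢.front n x ω).ncard})
      (fun ω (hω : (𝒢.front n x ω).Nonempty) => by
        by_cases h : K < (𝒢.front n x ω).ncard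
        · exact Or.inl h
        · exact Or.inr ⟨hω, h⟩) (measure_ne_top _ _)).trans (measureReal_union_le _ _)
    linarith [ha n]
  have hmark := mul_real_le_sum_real (μ := G.percolation p)
    (A := fun w => connEvent (𝒢.upper n x) x w) (fun w => measurableSet_connEvent)
    (𝒢.finite_band n x).toFinset (B := {ω | K < (𝒢.front n x ω).ncard}) (K := K) fun ω hω => by
      have hfin := (𝒢.finite_band n x).subset (front_subset_band (ω := ω) hn0)
      have hω' : K < (𝒢.front n x ω).ncard := hω
      rw [Set.ncard_eq_toFinset_card _ hfin] at hω'
      exact ⟨hfin.toFinset, by simpa using front_subset_band hn0, hω'.le,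
        fun w hw => ((Set.Finite.mem_toFinset _).1 hw).1⟩
  have hband := sum_band_mul_pow_le (𝒢 := 𝒢) (p := p) n x
  have hpow : 0 < (p : ℝ) ^ 𝒢.range := by positivity
  rw [div_lt_iff₀ (by positivity), div_lt_iff₀ hpow] at hK
  have h1 : (K : ℝ) * (ψ / 2) ≤ _ := (mul_le_mul_of_nonneg_left hlarge (by positivity)).trans hmark
  have h2 := (mul_le_mul_of_nonneg_right h1 hpow.le).trans hband
  have hR' : (0 : ℝ) < 𝒢.range := by exact_mod_cast hR
  nlinarith

end Genealogy

end SimpleGraph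

/-! ### Parents in the direction of an end -/

namespace SimpleGraph

open Filter

variable {V : Type*} {T : SimpleGraph V} {u v w x y : V} {n : ℕ}

/-- In a tree, only one neighbour of `x` is closer to `w` than `x` is. -/
theorem IsTree.eq_of_dist_eq_add_one (hT : T.IsTree) (hu : T.Adj x u) (hv : T.Adj x v)
    (hdu : T.dist x w = T.dist u w + 1) (hdv : T.dist x w = T.dist v w + 1) : u = v := by
  obtain ⟨p, hp⟩ := hT.connected.exists_walk_length_eq_dist u w
  obtain ⟨q, hq⟩ := hT.connected.exists_walk_length_eq_dist v w
  have hp' : (Walk.cons hu p).IsPath := Walk.isPath_of_length_eq_dist _ (by simp [hp, hdu])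
  have hq' : (Walk.cons hv q).IsPath := Walk.isPath_of_length_eq_dist _ (by simp [hq, hdv])
  have h := congrArg Subtype.val
    ((hT.isAcyclic.subsingleton_path x w).elim ⟨_, hp'⟩ ⟨_, hq'⟩)
  have := congrArg Walk.snd h
  simpa using this

theorem Iso.dist_map (g : T ≃g T) (x y : V) : T.dist (g x) (g y) = T.dist x y := by
  have key (g : T ≃g T) (x y : V) (h : T.Reachable x y) : T.dist (g x) (g y) ≤ T.dist x y := by
    obtain ⟨p, hp⟩ := h.exists_walk_length_eq_dist
    have := dist_le (p.map g.toHom)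
    rw [Walk.length_map, hp] at this
    exact this
  by_cases h : T.Reachable x y
  · refine le_antisymm (key g x y h) ?_
    have := key g.symm (g x) (g y) ((Iso.reachable_iff (φ := g)).2 h)
    simpa using this
  · rw [dist_eq_zero_of_not_reachable h,
      dist_eq_zero_of_not_reachable fun h' => h ((Iso.reachable_iff (φ := g)).1 h')]

theorem IsTree.dist_adj (hT : T.IsTree) (h : T.Adj u v) (w : V) :
    T.dist u w = T.dist v w + 1 ∨ T.dist v w = T.dist u w + 1 := by
  rw [dist_comm (u := u), dist_comm (u := v)]
  exact hT.dist_eq_dist_add_one_of_adj w h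

theorem Connected.exists_adj_dist_eq (hT : T.Connected) (hne : x ≠ w) :
    ∃ y, T.Adj x y ∧ T.dist x w = T.dist y w + 1 := by
  obtain ⟨p, hp⟩ := hT.exists_walk_length_eq_dist x w
  cases p with
  | nil => exact (hne rfl).elim
  | cons h p =>
    rename_i y
    refine ⟨y, h, le_antisymm ?_ ?_⟩
    · have := hT.dist_triangle (u := x) (v := y) (w := w)
      rw [dist_eq_one_iff_adj.2 h] at this
      omega
    · rw [Walk.length_cons] at hp
      have := dist_le p
      omega

namespace Ray

variable {r r' : T.Ray}

/-- The neighbour `y` of `x` lies in the direction of the ray `r`. -/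
def IsParent (r : T.Ray) (x y : V) : Prop :=
  T.Adj x y ∧ ∀ᶠ n in atTop, T.dist x (r.vertex n) = T.dist y (r.vertex n) + 1

/-- The value at `x` of the Busemann function of a ray: the distance from `x` to the vertices of the
ray eventually grows by one in each step, because it changes by one in each step and can never
decrease after an increase. -/
theorem exists_busemann (hT : T.IsTree) (r : T.Ray) (x : V) :
    ∃ h : ℤ, ∀ᶠ n : ℕ in atTop, (T.dist x (r.vertex n) : ℤ) = h + n := by
  have hstep (n : ℕ) := hT.dist_adj (r.adj n) x
  simp only [dist_comm (v := x)] at hstep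
  have hinc (n : ℕ) (hn : T.dist x (r.vertex (n + 1)) = T.dist x (r.vertex n) + 1) :
      T.dist x (r.vertex (n + 2)) = T.dist x (r.vertex (n + 1)) + 1 := by
    refine (hstep (n + 1)).resolve_left fun h => ?_
    have := hT.eq_of_dist_eq_add_one (w := x) (r.adj n).symm (r.adj (n + 1))
      (by rw [dist_comm, hn, dist_comm]) (by rw [dist_comm, h, dist_comm])
    have := r.injective this
    omega
  obtain ⟨N, hN⟩ : ∃ N, T.dist x (r.vertex (N + 1)) = T.dist x (r.vertex N) + 1 := by
    by_contra! hne
    have (n : ℕ) : T.dist x (r.vertex n) + n = T.dist x (r.vertex 0) := by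
      induction n with
      | zero => rfl
      | succ n ih =>
        have := (hstep n).resolve_right (hne n)
        omega
    have := this (T.dist x (r.vertex 0) + 1)
    omega
  have hall (k : ℕ) : T.dist x (r.vertex (N + k)) = T.dist x (r.vertex N) + k ∧
      T.dist x (r.vertex (N + k + 1)) = T.dist x (r.vertex (N + k)) + 1 := by
    induction k with
    | zero => exact ⟨rfl, hN⟩
    | succ k ih => exact ⟨by rw [← add_assoc, ih.2, ih.1]; rfl, hinc _ ih.2⟩
  refine ⟨T.dist x (r.vertex N) - N, eventually_atTop.2 ⟨N, fun n hn => ?_⟩⟩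
  obtain ⟨k, rfl⟩ := Nat.exists_eq_add_of_le hn
  rw [(hall k).1]
  push_cast
  ring

theorem IsParent.unique (hT : T.IsTree) (h : r.IsParent x u) (h' : r.IsParent x v) : u = v := by
  obtain ⟨n, hn, hn'⟩ := (h.2.and h'.2).exists
  exact hT.eq_of_dist_eq_add_one h.1 h'.1 hn hn'

/-- If the ray moves away from `x` from its `n`-th vertex on, it also moves away from the neighbour
of `x` that is closer to the `n`-th vertex. -/
theorem dist_eq_of_adj (hT : T.IsTree) (hadj : T.Adj x y) {k : ℕ}
    (hx : ∀ j, T.dist x (r.vertex (n + j)) = k + 1 + j)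
    (hy : T.dist y (r.vertex n) = k) (j : ℕ) : T.dist y (r.vertex (n + j)) = k + j := by
  induction j with
  | zero => exact hy
  | succ j ih =>
    have h1 := hx (j + 1)
    have h2 := hT.dist_adj hadj (r.vertex (n + (j + 1)))
    have h3 := hT.dist_adj (r.adj (n + j)) y
    rw [dist_comm (v := y), dist_comm (v := y)] at h3
    rw [← add_assoc n] at *
    omega

/-- From some vertex on, the ray moves away from `x` in each step. -/
theorem exists_dist_eq (hT : T.IsTree) (r : T.Ray) (x : V) :
    ∃ N, ∀ n ≥ N, ∀ j, T.dist x (r.vertex (n + j)) = T.dist x (r.vertex n) + j := by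
  obtain ⟨h, hh⟩ := r.exists_busemann hT x
  obtain ⟨N, hN⟩ := eventually_atTop.1 hh
  refine ⟨N, fun n hn j => ?_⟩
  have h1 := hN n hn
  have h2 := hN (n + j) (by omega)
  push_cast at h2
  omega

theorem isParent_of_dist_eq (hT : T.IsTree) (hadj : T.Adj x y) {k : ℕ}
    (hx : ∀ j, T.dist x (r.vertex (n + j)) = k + 1 + j)
    (hy : T.dist y (r.vertex n) = k) : r.IsParent x y := by
  refine ⟨hadj, eventually_atTop.2 ⟨n, fun m hm => ?_⟩⟩
  obtain ⟨j, rfl⟩ := Nat.exists_eq_add_of_le hm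
  rw [hx j, dist_eq_of_adj hT hadj hx hy j]
  omega

theorem exists_isParent (hT : T.IsTree) (r : T.Ray) (x : V) : ∃ y, r.IsParent x y := by
  obtain ⟨N, hN⟩ := r.exists_dist_eq hT x
  have hne : x ≠ r.vertex (N + 1) := fun h => by
    have := hN N le_rfl 1
    rw [← h, dist_self] at this
    omega
  obtain ⟨y, hadj, hy⟩ := hT.connected.exists_adj_dist_eq hne
  exact ⟨y, isParent_of_dist_eq (n := N + 1) hT hadj (fun j => by rw [hN _ (by omega), hy]) rfl⟩

/-- Following the parents from `x` leads to the vertices of the ray from which the ray moves away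
from `x`. -/
theorem iterate_eq_vertex (hT : T.IsTree) {f : V → V} (hf : ∀ x, r.IsParent x (f x)) (k : ℕ) :
    ∀ x, (∀ j, T.dist x (r.vertex (n + j)) = k + j) → f^[k] x = r.vertex n := by
  induction k with
  | zero => exact fun x hx => hT.connected.dist_eq_zero_iff.1 (hx 0)
  | succ k ih =>
    intro x hx
    have hne : x ≠ r.vertex n := fun h => by
      have := hx 0
      rw [add_zero, ← h, dist_self] at this
      omega
    obtain ⟨y, hadj, hy⟩ := hT.connected.exists_adj_dist_eq hne
    have hk : T.dist y (r.vertex n) = k := by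
      have := hx 0
      rw [add_zero] at this
      omega
    have hfx : f x = y := (hf x).unique hT (isParent_of_dist_eq hT hadj hx hk)
    rw [Function.iterate_succ_apply, hfx]
    exact ih y (dist_eq_of_adj hT hadj hx hk)

theorem isParent_of_adj_of_ne (hT : T.IsTree) (hxy : r.IsParent x y) (hadj : T.Adj x v)
    (hne : v ≠ y) : r.IsParent v x := by
  refine ⟨hadj.symm, hxy.2.mono fun n hn => ?_⟩
  exact (hT.dist_adj hadj _).resolve_left fun h =>
    hne (hT.eq_of_dist_eq_add_one hadj hxy.1 h hn)

theorem IsParent.map (h : r.IsParent x y) (g : T ≃g T) : (r.map g).IsParent (g x) (g y) := by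
  refine ⟨g.map_adj_iff.2 h.1, h.2.mono fun n hn => ?_⟩
  change T.dist (g x) (g _) = T.dist (g y) (g _) + 1
  rw [Iso.dist_map, Iso.dist_map, hn]

/-- Equivalent rays determine the same parents, since they have far vertices in common. -/
theorem IsParent.of_equiv (hT : T.IsTree) (h : r.IsParent x y)
    (hr : (symmDiff r.edges r'.edges).Finite) : r'.IsParent x y := by
  obtain ⟨z, hz⟩ := r'.exists_isParent hT x
  suffices y = z by rwa [this]
  have hinj : Function.Injective fun n => s(r.vertex n, r.vertex (n + 1)) := fun m n hmn => by
    rcases Sym2.eq_iff.1 hmn with h | h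
    · exact r.injective h.1
    · have h1 := r.injective h.1
      have h2 := r.injective h.2
      omega
  have h1 : ∀ᶠ n in atTop, s(r.vertex n, r.vertex (n + 1)) ∈ r'.edges := by
    rw [← Nat.cofinite_eq_atTop]
    refine (hr.preimage hinj.injOn).subset fun n hn => ?_
    exact Or.inl ⟨⟨n, rfl⟩, hn⟩
  obtain ⟨N, hN⟩ := eventually_atTop.1 hz.2
  have h2 : ∀ᶠ n in atTop, r.vertex n ∉ r'.vertex '' {m | m < N} := by
    rw [← Nat.cofinite_eq_atTop]
    refine (((Set.finite_lt_nat N).image r'.vertex).preimage r.injective.injOn).subset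
      fun n hn => ?_
    simpa using hn
  obtain ⟨n, hn, hn1, hn2⟩ := (h.2.and (h1.and h2)).exists
  obtain ⟨m, hm⟩ : ∃ m, r'.vertex m = r.vertex n := by
    obtain ⟨m, hm⟩ := hn1
    rcases Sym2.eq_iff.1 hm with h | h
    · exact ⟨m, h.1⟩
    · exact ⟨m + 1, h.2⟩
  have hmN : N ≤ m := by
    by_contra! hlt
    exact hn2 ⟨m, hlt, hm⟩
  have := hN m hmN
  rw [hm] at this
  exact hT.eq_of_dist_eq_add_one h.1 hz.1 hn this

end Ray

/-- The distinguished end of a decorated tree provides parents and heights; the automorphisms in `L`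
fix the end, so they respect parents. -/
theorem IsDecoratedTree.nonempty_genealogy {G : SimpleGraph V} (hG : G.IsDecoratedTree) :
    Nonempty (Genealogy G) := by
  classical
  obtain ⟨d, T, ξ, L, E', hd, hT, ⟨_, hreg⟩, hfix, htrans, hE', rfl, ⟨hfin⟩⟩ := hG
  obtain ⟨r, rfl⟩ := Quotient.exists_rep ξ
  choose f hf using r.exists_isParent hT
  choose h hh using r.exists_busemann hT
  refine ⟨⟨f, h, fun x => ?_, fun x => Or.inl (hf x).1, fun x y => ?_, fun x => Set.toFinite _,
    fun x => ?_, fun u v => ?_⟩⟩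
  · obtain ⟨n, h1, h2, h3⟩ := ((hh x).and ((hh (f x)).and (hf x).2)).exists
    omega
  · obtain ⟨N, hN⟩ := r.exists_dist_eq hT x
    obtain ⟨N', hN'⟩ := r.exists_dist_eq hT y
    refine ⟨T.dist x (r.vertex (max N N')), T.dist y (r.vertex (max N N')), ?_⟩
    rw [Ray.iterate_eq_vertex hT hf _ x (hN _ (le_max_left _ _)),
      Ray.iterate_eq_vertex hT hf _ y (hN' _ (le_max_right _ _))]
  · have hcard : 1 < ((T.neighborFinset x).erase (f x)).card := by
      rw [Finset.card_erase_of_mem (by simpa using (hf x).1), card_neighborFinset_eq_degree,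
        hreg.degree_eq]
      omega
    obtain ⟨y, hy, z, hz, hyz⟩ := Finset.one_lt_card.1 hcard
    simp only [Finset.mem_erase, mem_neighborFinset] at hy hz
    exact ⟨y, z, hyz, (hf y).unique hT (Ray.isParent_of_adj_of_ne hT (hf x) hy.2 hy.1),
      (hf z).unique hT (Ray.isParent_of_adj_of_ne hT (hf x) hz.2 hz.1)⟩
  · obtain ⟨g, hg, hguv⟩ := htrans u v
    have hE (e : Sym2 V) : Sym2.map g e ∈ E' ↔ e ∈ E' := by
      conv_lhs => rw [← hE' g hg]
      exact (Sym2.map.injective g.injective).mem_set_image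
    refine ⟨{ g.toEquiv with map_rel_iff' := fun {a b} => ?_ }, fun x => ?_, hguv⟩
    · have h1 := hE s(a, b)
      have h2 := g.map_adj_iff (v := a) (w := b)
      simp only [Sym2.map_mk] at h1
      simpa [h1] using or_congr_left h2
    · refine (hf (g x)).unique hT ?_ |>.symm
      exact ((hf x).map g).of_equiv hT (Quotient.exact (hfix g hg))

end SimpleGraph

/-! ### Decorated trees at the critical point -/

theorem theorem2p1 {V : Type*} (G : SimpleGraph V) (hG : G.IsDecoratedTree) :
    (∀ᵐ ω ∂(G.percolation G.criticalProb), ∀ o : V, (G.cluster ω o).Finite) ∧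
    ∀ p : unitInterval, p < 1 → ∃ c : ℝ, 0 < c ∧ ∀ x y : V,
      (G.percolation p).real {ω | y ∈ G.cluster ω x} ≤ Real.exp (-c * (G.dist x y : ℝ)) := by
  obtain ⟨𝒢⟩ := hG.nonempty_genealogy
  refine ⟨?_, fun p hp => 𝒢.exists_real_connEvent_le_exp hp⟩
  by_contra hne
  have hinf : G.percolation G.criticalProb {ω | ∃ o, (G.cluster ω o).Infinite} ≠ 0 := by
    refine fun h => hne ?_
    rw [ae_iff]
    simp only [not_forall]
    exact h
  have hV : Nonempty V := by
    by_contra hV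
    refine hinf ?_
    have : {ω | ∃ o, (G.cluster ω o).Infinite} = ∅ := by
      ext ω
      exact iff_of_false (fun ⟨o, _⟩ => hV ⟨o⟩) id
    rw [this, measure_empty]
  obtain ⟨o⟩ := id hV
  have hle {n : ℕ} {p : unitInterval} (h : 1 < 𝒢.meanOffspring n o p) : G.criticalProb ≤ p :=
    sInf_le (𝒢.measure_exists_infinite_eq_one fun x => by
      rwa [SimpleGraph.Genealogy.meanOffspring_eq x o])
  have hlt : G.criticalProb < 1 := by
    -- The tree alone percolates above `1 / 2`.
    refine lt_of_le_of_lt (hle (n := 1) (p := ⟨3 / 4, by norm_num, by norm_num⟩) ?_)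
      (Subtype.mk_lt_mk.2 (by norm_num))
    refine lt_of_lt_of_le ?_ (SimpleGraph.Genealogy.two_mul_le_meanOffspring_one o)
    norm_num
  have hpos : 0 < G.criticalProb := by
    refine lt_of_le_of_ne unitInterval.nonneg' fun h0 => hinf ?_
    have := 𝒢.countable
    rw [← h0, SimpleGraph.percolation, setBernoulli_zero, Measure.dirac_apply]
    refine Set.indicator_of_notMem ?_ _
    rintro ⟨x, hx⟩
    refine hx ?_
    exact (Set.finite_singleton x).subset fun y hy =>
      SimpleGraph.connEvent_induction (P := (· = x)) hy rfl fun _ _ _ h => h.elim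
  obtain ⟨x, hx⟩ := 𝒢.exists_infiniteBelow_pos hpos hlt hinf
  obtain ⟨n, hn⟩ := SimpleGraph.Genealogy.exists_one_lt_meanOffspring hpos hlt hx
  rw [SimpleGraph.Genealogy.meanOffspring_eq x o] at hn
  have hev := (𝒢.continuous_meanOffspring n o).continuousAt.eventually_const_lt hn
  have hbot : (nhdsWithin G.criticalProb (Set.Iio G.criticalProb)).NeBot :=
    nhdsLT_neBot_of_exists_lt ⟨0, hpos⟩
  obtain ⟨p, hp, hp'⟩ := ((hev.filter_mono nhdsWithin_le_nhds).and
    (eventually_mem_nhdsWithin (s := Set.Iio G.criticalProb))).exists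
  exact absurd (hle hp) (not_le.2 hp')
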